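/- Theorem (General Principle). Let $(X,d)$ be a compact metric space and let $\{\varepsilon_n,A_n\}_{n\in\mathbb N}$ be an adjusted approximative sequence of $X$: the $\varepsilon_n$ are positive reals decreasing to $0$, each $A_n\subset X$ is finite, for every $x\in X$ there is $a\in A_n$ with $d(x,a)<\varepsilon_n$, and $\varepsilon_{n+1}<\frac{\varepsilon_n-\gamma_n}{2}$, where $\gamma_n=\sup\{d(x,A_n):x\in X\}$. Put $q_n(x)=\{a\in A_n : d(x,a)=d(x,A_n)\}$. Let $X_n=U_{2\varepsilon_n}(A_n)$ be the set of nonempty subsets $C\subset A_n$ with $\operatorname{diam} C<2\varepsilon_n$, partially ordered by inclusion, and let $p_{n,n+1}:X_{n+1}\to X_n$, $p_{n,n+1}(C)=\bigcup_{c\in C}q_n(c)$. Consider the following inverse sequences of polyhedra $|K_n|$ (geometric realizations with the weak topology), whose bonding morphisms are the homotopy classes of the realizations of the indicated simplicial maps $K_{n+1}\to K_n$: 1. the Alexandroff–McCord sequence: $K_n=\mathcal K(X_n)$, whose simplices are the nonempty finite chains of $X_n$, with the map $C\mapsto p_{n,n+1}(C)$; 2. the Čech sequence: $K_n$ is the nerve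 of the covering $\{B(a,\varepsilon_n):a\in A_n\}$ of $X$ by open balls, with a map $B(a,\varepsilon_{n+1})\mapsto B(b,\varepsilon_n)$, where $b\in q_n(a)$ is chosen arbitrarily; 3. the witness sequence: $K_n=\mathcal W_n$, whose simplices are the nonempty sets $\sigma\subset A_n$ such that every nonempty $\tau\subset\sigma$ admits $x\in X$ with $\sum_{a\in\tau}d(x,a)<|\tau|\,\varepsilon_n$, with a map $a\mapsto b$, where $b\in q_n(a)$ is chosen arbitrarily; 4. the Vietoris–Rips sequence: $K_n=\mathcal R_{2\varepsilon_n}(A_n)$, whose simplices are the nonempty subsets of $A_n$ of diameter $<2\varepsilon_n$, with a map $a\mapsto b$, where $b\in q_n(a)$ is chosen arbitrarily; 5. the upper Dowker sequence: the simplices of $K_n$ are the nonempty finite subsets of $X_n$ that have an upper bound in $X_n$, with the map $C\mapsto p_{n,n+1}(C)$; 6. the lower Dowker sequence: the simplices of $K_n$ are the nonempty finite subsets of $X_n$ that have a lower bound in $X_n$, with the map $C\mapsto p_{n,n+1}(C)$. Each of these inverse sequences (for every choice in 2, 3 and 4) is an $\mathrm{HPol}$-expansion of $X$. That is, denoting it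 by $\mathbf K$, its terms lie in $\mathrm{HPol}$ (the full subcategory of the homotopy category $\mathrm{HTop}$ of topological spaces on the spaces of the homotopy type of a polyhedron), and there is a morphism $\mathbf p:X\to\mathbf K$ of pro-$\mathrm{HTop}$ such that for every inverse system $\mathbf Y$ in $\mathrm{HPol}$ and every morphism $\mathbf h:X\to\mathbf Y$ of pro-$\mathrm{HTop}$ there is a unique morphism $\mathbf f:\mathbf K\to\mathbf Y$ with $\mathbf f\,\mathbf p=\mathbf h$. -/

import Mathlib

open CategoryTheory Topology

universe w u v

noncomputable section

namespace PolyhedralShape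

/-! ## Simplicial complexes, simplicial maps and their realizations -/

/-- A simplicial map: a map of vertices sending simplices to simplices. -/
structure SimplicialMap {V : Type u} {W : Type v}
    (K : AbstractSimplicialComplex V) (L : AbstractSimplicialComplex W) where
  toFun : V → W
  map_faces : ∀ s ∈ K.faces, ∀ t : Finset W, (t : Set W) = toFun '' (s : Set V) → t ∈ L.faces

theorem nonempty_of_coe_eq_image {V : Type u} {W : Type v} {f : V → W} {s : Finset V}
    {t : Finset W} (hs : s.Nonempty) (ht : (t : Set W) = f '' (s : Set V)) : t.Nonempty := by
  obtain ⟨v, hv⟩ := hs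
  exact ⟨f v, Finset.mem_coe.1 (ht ▸ Set.mem_image_of_mem f (Finset.mem_coe.2 hv))⟩

/-- The points of the geometric realization `|K|`: formal convex combinations of vertices of `K`
(barycentric coordinates) whose support is a simplex of `K`. -/
def Realization {V : Type u} (K : AbstractSimplicialComplex V) : Type u :=
  {x : V →₀ ℝ // (∀ v, 0 ≤ x v) ∧ x.support ∈ K.faces ∧ (x.sum fun _ r => r) = 1}

/-- The closed simplex of `|K|` spanned by a finite set `s` of vertices. -/
def ClosedSimplex {V : Type u} (K : AbstractSimplicialComplex V) (s : Finset V) : Type u :=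
  {x : Realization K // x.1.support ⊆ s}

/-- A closed simplex carries its Euclidean topology, the one of the barycentric coordinates. -/
instance {V : Type u} (K : AbstractSimplicialComplex V) (s : Finset V) :
    TopologicalSpace (ClosedSimplex K s) :=
  TopologicalSpace.induced (fun x (v : V) => x.1.1 v) inferInstance

/-- The weak topology of `|K|`: a set is closed (open) if and only if it meets each closed simplex
in a closed (open) subset of that simplex. -/
instance {V : Type u} (K : AbstractSimplicialComplex V) : TopologicalSpace (Realization K) :=
  ⨆ s : K.faces, TopologicalSpace.coinduced
    (fun x : ClosedSimplex K (s : Finset V) => x.1) inferInstance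

/-- The topology of `|K|` in terms of closed sets. -/
theorem Realization.isClosed_iff {V : Type u} (K : AbstractSimplicialComplex V)
    (C : Set (Realization K)) :
    IsClosed C ↔ ∀ s ∈ K.faces, IsClosed {x : ClosedSimplex K s | x.1 ∈ C} := by
  rw [isClosed_iSup_iff]
  simp only [isClosed_coinduced, Subtype.forall]
  rfl

/-- The underlying map of the realization of a simplicial map, linear on each simplex. -/
def SimplicialMap.realizationFun {V : Type u} {W : Type v} {K : AbstractSimplicialComplex V}
    {L : AbstractSimplicialComplex W} (f : SimplicialMap K L) (x : Realization K) :
    Realization L :=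
  ⟨x.1.mapDomain f.toFun, by
    classical
    obtain ⟨x, h0, hs, h1⟩ := x
    have hsum : ((x.mapDomain f.toFun).sum fun _ r => r) = 1 := by
      rw [Finsupp.sum_mapDomain_index (fun _ => rfl) (fun _ _ _ => rfl)]
      exact h1
    refine ⟨fun w => ?_, ?_, hsum⟩
    · rw [Finsupp.mapDomain, Finsupp.sum_apply]
      refine Finset.sum_nonneg fun v _ => ?_
      change 0 ≤ Finsupp.single (f.toFun v) (x v) w
      rw [Finsupp.single_apply]
      split_ifs
      · exact h0 v
      · exact le_rfl
    · refine (L.isRelLowerSet_faces (f.map_faces x.support hs (x.support.image f.toFun)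
        (by simp))).2 Finsupp.mapDomain_support ?_
      rw [Finset.nonempty_iff_ne_empty]
      intro h
      rw [Finsupp.support_eq_empty] at h
      simp [h] at hsum⟩

theorem SimplicialMap.continuous_realizationFun {V : Type u} {W : Type v}
    {K : AbstractSimplicialComplex V} {L : AbstractSimplicialComplex W} (f : SimplicialMap K L) :
    Continuous f.realizationFun := by
  classical
  rw [continuous_iSup_dom]
  rintro ⟨s, hs⟩
  rw [continuous_coinduced_dom]
  have ht : s.image f.toFun ∈ L.faces := f.map_faces s hs _ (by simp)
  have hincl : Continuous (fun y : ClosedSimplex L (s.image f.toFun) => y.1) := by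
    rw [continuous_iff_coinduced_le]
    exact le_iSup (fun t : L.faces => TopologicalSpace.coinduced
      (fun y : ClosedSimplex L (t : Finset W) => y.1) inferInstance) ⟨_, ht⟩
  let g : ClosedSimplex K s → ClosedSimplex L (s.image f.toFun) := fun x =>
    ⟨f.realizationFun x.1, Finsupp.mapDomain_support.trans (Finset.image_subset_image x.2)⟩
  have hg : Continuous g := by
    rw [continuous_induced_rng, continuous_pi_iff]
    intro a
    have : (fun x : ClosedSimplex K s => (g x).1.1 a) =
        fun x => ∑ v ∈ s, if f.toFun v = a then x.1.1 v else 0 := by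
      funext x
      change (x.1.1.mapDomain f.toFun) a = _
      rw [Finsupp.mapDomain, Finsupp.sum_apply,
        Finsupp.sum_of_support_subset _ x.2 _ (by simp)]
      simp [Finsupp.single_apply]
    change Continuous (fun x : ClosedSimplex K s => (g x).1.1 a)
    rw [this]
    refine continuous_finsetSum _ fun v _ => ?_
    split_ifs
    · exact (continuous_apply v).comp continuous_induced_dom
    · exact continuous_const
  exact hincl.comp hg

/-- The realization `|f| : |K| → |L|` of a simplicial map. -/
def SimplicialMap.realization {V : Type u} {W : Type v} {K : AbstractSimplicialComplex V}
    {L : AbstractSimplicialComplex W} (f : SimplicialMap K L) :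
    C(Realization K, Realization L) :=
  ⟨f.realizationFun, f.continuous_realizationFun⟩

/-! ## The homotopy category and polyhedra -/

/-- The homotopy relation between continuous maps. -/
def homotopyRel : HomRel TopCat.{u} := fun _ _ f g => f.hom.Homotopic g.hom

instance : Congruence homotopyRel.{u} where
  equivalence :=
    { refl := fun f => ContinuousMap.Homotopic.refl f.hom
      symm := fun h => ContinuousMap.Homotopic.symm h
      trans := fun h h' => ContinuousMap.Homotopic.trans h h' }
  comp_left := fun f _ _ h => ContinuousMap.Homotopic.comp h (ContinuousMap.Homotopic.refl f.hom)
  comp_right := fun g h => ContinuousMap.Homotopic.comp (ContinuousMap.Homotopic.refl g.hom) h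

/-- The category `HTop` of topological spaces and homotopy classes of continuous maps. -/
abbrev HTop := CategoryTheory.Quotient homotopyRel.{u}

/-- A topological space as an object of `HTop`. -/
def HTop.of (X : Type u) [TopologicalSpace X] : HTop.{u} :=
  (CategoryTheory.Quotient.functor homotopyRel).obj (TopCat.of X)

/-- The homotopy class of a continuous map. -/
def HTop.ofMap {X Y : Type u} [TopologicalSpace X] [TopologicalSpace Y] (f : C(X, Y)) :
    HTop.of X ⟶ HTop.of Y :=
  (CategoryTheory.Quotient.functor homotopyRel).map (TopCat.ofHom f)

/-- The objects of `HPol`, a full subcategory of `HTop`: the spaces of the homotopy type of a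
polyhedron `|K|`. -/
def IsHPol (P : HTop.{u}) : Prop :=
  ∃ (V : Type u) (K : AbstractSimplicialComplex V), Nonempty (P ≅ HTop.of (Realization K))

/-! ## Inverse systems and pro-categories -/

/-- An inverse system in `C`, indexed by a directed preordered set. -/
structure InverseSystem (C : Type u) [Category.{v} C] where
  Index : Type w
  [preorder : Preorder Index]
  [directed : IsDirectedOrder Index]
  [nonempty : Nonempty Index]
  system : Indexᵒᵖ ⥤ C

attribute [instance] InverseSystem.preorder InverseSystem.directed InverseSystem.nonempty

namespace InverseSystem

variable {C : Type u} [Category.{v} C]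

/-- The terms of an inverse system. -/
def term (X : InverseSystem.{w} C) (i : X.Index) : C := X.system.obj (Opposite.op i)

/-- The bonding morphisms `X_j ⟶ X_i`, for `i ≤ j`, of an inverse system. -/
def bond (X : InverseSystem.{w} C) {i j : X.Index} (h : i ≤ j) : X.term j ⟶ X.term i :=
  X.system.map (homOfLE h).op

theorem bond_comp (X : InverseSystem.{w} C) {i j k : X.Index} (h : i ≤ j) (h' : j ≤ k) :
    X.bond h' ≫ X.bond h = X.bond (h.trans h') := by
  exact (X.system.map_comp (homOfLE h').op (homOfLE h).op).symm

theorem bond_refl (X : InverseSystem.{w} C) (i : X.Index) : X.bond (le_refl i) = 𝟙 _ :=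
  X.system.map_id _

/-- Two morphisms from terms of `X` to `c` agree if they become equal when composed with bonding
morphisms of `X` from some common later term. -/
def Agree (X : InverseSystem.{w} C) {c : C} {i j : X.Index} (f : X.term i ⟶ c)
    (g : X.term j ⟶ c) : Prop :=
  ∃ (k : X.Index) (hi : i ≤ k) (hj : j ≤ k), X.bond hi ≫ f = X.bond hj ≫ g

theorem Agree.refl {X : InverseSystem.{w} C} {c : C} {i : X.Index} (f : X.term i ⟶ c) :
    X.Agree f f := ⟨i, le_rfl, le_rfl, rfl⟩

theorem Agree.symm {X : InverseSystem.{w} C} {c : C} {i j : X.Index} {f : X.term i ⟶ c}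
    {g : X.term j ⟶ c} (h : X.Agree f g) : X.Agree g f := by
  obtain ⟨k, hi, hj, e⟩ := h
  exact ⟨k, hj, hi, e.symm⟩

theorem Agree.trans {X : InverseSystem.{w} C} {c : C} {i j k : X.Index} {f : X.term i ⟶ c}
    {g : X.term j ⟶ c} {h : X.term k ⟶ c} (a : X.Agree f g) (b : X.Agree g h) :
    X.Agree f h := by
  obtain ⟨m, hi, hj, e⟩ := a
  obtain ⟨n, hj', hk, e'⟩ := b
  obtain ⟨l, hm, hn⟩ := exists_ge_ge m n
  refine ⟨l, hi.trans hm, hk.trans hn, ?_⟩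
  rw [← X.bond_comp hi hm, ← X.bond_comp hk hn, Category.assoc, Category.assoc, e, ← e',
    ← Category.assoc, ← Category.assoc, X.bond_comp, X.bond_comp]

theorem Agree.comp {X : InverseSystem.{w} C} {c d : C} {i j : X.Index} {f : X.term i ⟶ c}
    {g : X.term j ⟶ c} (a : X.Agree f g) (h : c ⟶ d) : X.Agree (f ≫ h) (g ≫ h) := by
  obtain ⟨m, hi, hj, e⟩ := a
  exact ⟨m, hi, hj, by rw [← Category.assoc, e, Category.assoc]⟩

/-- A morphism of inverse systems `(f_j, φ) : X → Y`: a function `φ` from the indices of `Y` to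
those of `X` and morphisms `f_j : X_{φ j} ⟶ Y_j` such that for `j ≤ j'` there is
`i ≥ φ j, φ j'` for which the two morphisms `X_i ⟶ Y_j` obtained through `f_j` and through
`f_{j'}` coincide. -/
structure PreHom (X Y : InverseSystem.{w} C) where
  index : Y.Index → X.Index
  hom : ∀ j, X.term (index j) ⟶ Y.term j
  compat : ∀ {j j' : Y.Index} (h : j ≤ j'), X.Agree (hom j) (hom j' ≫ Y.bond h)

theorem PreHom.agree {X Y : InverseSystem.{w} C} (f : PreHom X Y) {c : C} {i j : Y.Index}
    {a : Y.term i ⟶ c} {b : Y.term j ⟶ c} (h : Y.Agree a b) :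
    X.Agree (f.hom i ≫ a) (f.hom j ≫ b) := by
  obtain ⟨k, hi, hj, e⟩ := h
  refine ((f.compat hi).comp a).trans (Agree.trans ?_ ((f.compat hj).comp b).symm)
  rw [Category.assoc, Category.assoc, e]
  exact Agree.refl _

/-- Two morphisms of inverse systems are equivalent if their `j`-th components agree on some later
term, for every `j`. -/
instance PreHom.setoid (X Y : InverseSystem.{w} C) : Setoid (PreHom X Y) where
  r f g := ∀ j, X.Agree (f.hom j) (g.hom j)
  iseqv :=
    { refl := fun f j => Agree.refl (f.hom j)
      symm := fun h j => (h j).symm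
      trans := fun h h' j => (h j).trans (h' j) }

/-- The identity morphism of an inverse system. -/
def PreHom.id (X : InverseSystem.{w} C) : PreHom X X where
  index i := i
  hom i := 𝟙 (X.term i)
  compat {j j'} h := ⟨j', h, le_rfl, by rw [X.bond_refl]; simp⟩

/-- The composition of morphisms of inverse systems. -/
def PreHom.comp {X Y Z : InverseSystem.{w} C} (f : PreHom X Y) (g : PreHom Y Z) : PreHom X Z where
  index k := f.index (g.index k)
  hom k := f.hom (g.index k) ≫ g.hom k
  compat h := by
    rw [Category.assoc]
    exact f.agree (g.compat h)

/-- The category pro-`C`: inverse systems and equivalence classes of their morphisms. -/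
instance : Category (InverseSystem.{w} C) where
  Hom X Y := _root_.Quotient (PreHom.setoid X Y)
  id X := ⟦PreHom.id X⟧
  comp {X Y Z} := Quotient.map₂ PreHom.comp (by
    intro f f' hf g g' hg k
    exact Agree.trans (f.agree (hg k)) ((hf (g'.index k)).comp (g'.hom k)))
  id_comp := by
    rintro X Y ⟨f⟩
    refine Quotient.sound fun k => ?_
    change X.Agree (𝟙 _ ≫ f.hom k) (f.hom k)
    rw [Category.id_comp]
    exact Agree.refl _
  comp_id := by
    rintro X Y ⟨f⟩
    refine Quotient.sound fun k => ?_
    change X.Agree (f.hom k ≫ 𝟙 _) (f.hom k)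
    rw [Category.comp_id]
    exact Agree.refl _
  assoc := by
    rintro W X Y Z ⟨f⟩ ⟨g⟩ ⟨h⟩
    refine Quotient.sound fun k => ?_
    change W.Agree ((f.hom _ ≫ g.hom _) ≫ h.hom k) (f.hom _ ≫ (g.hom _ ≫ h.hom k))
    rw [Category.assoc]
    exact Agree.refl _

/-- An object of `C` as an inverse system with one term. -/
def const (c : C) : InverseSystem.{w} C where
  Index := PUnit.{w + 1}
  system := (Functor.const _).obj c

instance : IsDirectedOrder (ULift.{w} ℕ) :=
  ⟨fun a b => ⟨⟨max a.down b.down⟩, le_max_left a.down b.down, le_max_right a.down b.down⟩⟩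

/-- The inverse sequence with terms `K n` and bonding morphisms `p n : K (n + 1) ⟶ K n`. -/
def ofSequence (K : ℕ → C) (p : ∀ n, K (n + 1) ⟶ K n) : InverseSystem.{w} C where
  Index := ULift.{w} ℕ
  system :=
    (show Monotone (ULift.down : ULift.{w} ℕ → ℕ) from fun _ _ h => h).functor.op ⋙
      Functor.ofOpSequence p

end InverseSystem

/-! ## `HPol`-expansions -/

/-- The inverse system `S` is an `HPol`-expansion of `X`: its terms are in `HPol`, and there is a
morphism `p : X ⟶ S` of pro-`HTop` through which every morphism from `X` to an inverse system in
`HPol` factors uniquely. -/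
def IsHPolExpansion (X : Type u) [TopologicalSpace X] (S : InverseSystem.{w} HTop.{u}) : Prop :=
  (∀ i, IsHPol (S.term i)) ∧
    ∃ p : InverseSystem.const (HTop.of X) ⟶ S,
      ∀ T : InverseSystem.{w} HTop.{u}, (∀ j, IsHPol (T.term j)) →
        ∀ h : InverseSystem.const (HTop.of X) ⟶ T, ∃! f : S ⟶ T, p ≫ f = h

/-- The inverse sequence of polyhedra `|K n|` and of homotopy classes of the realizations of
simplicial maps `f n : K (n + 1) → K n`. -/
def polyhedralSequence {V : ℕ → Type u} (K : ∀ n, AbstractSimplicialComplex (V n))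
    (f : ∀ n, SimplicialMap (K (n + 1)) (K n)) : InverseSystem.{w} HTop.{u} :=
  InverseSystem.ofSequence (fun n => HTop.of (Realization (K n)))
    (fun n => HTop.ofMap (f n).realization)

/-! ## Simplicial complexes of metric spaces, covers and posets -/

/-- The Vietoris–Rips complex: the simplices are the nonempty finite sets of diameter `< ε`. -/
def ripsComplex (Y : Type u) [MetricSpace Y] (ε : ℝ) (hε : 0 < ε) :
    AbstractSimplicialComplex Y where
  faces := {s | s.Nonempty ∧ Metric.diam (s : Set Y) < ε}
  isRelLowerSet_faces := fun s hs => ⟨hs.1, fun t hts ht => ⟨ht,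
    (Metric.diam_mono (Finset.coe_subset.2 hts) s.finite_toSet.isBounded).trans_lt hs.2⟩⟩
  singleton_mem v := by simpa using hε

/-- The nerve of a family `𝒰` of nonempty sets: the vertices are the members of `𝒰`, and the
simplices are its nonempty finite subsets with nonempty intersection. -/
def nerve {Y : Type u} (𝒰 : Set (Set Y)) (h𝒰 : ∀ U ∈ 𝒰, U.Nonempty) :
    AbstractSimplicialComplex 𝒰 where
  faces := {s | s.Nonempty ∧ ∃ x : Y, ∀ U ∈ s, x ∈ (U : Set Y)}
  isRelLowerSet_faces := fun _ hs => ⟨hs.1, fun _ hts ht => ⟨ht,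
    hs.2.imp fun _ hx U hU => hx U (hts hU)⟩⟩
  singleton_mem U := ⟨Finset.singleton_nonempty U, by
    obtain ⟨x, hx⟩ := h𝒰 U.1 U.2
    exact ⟨x, by simpa using hx⟩⟩

/-- The McCord complex of a poset: the simplices are the nonempty finite chains. -/
def mcCordComplex (P : Type u) [PartialOrder P] : AbstractSimplicialComplex P where
  faces := {s | s.Nonempty ∧ IsChain (· ≤ ·) (s : Set P)}
  isRelLowerSet_faces := fun _ hs => ⟨hs.1, fun _ hts ht =>
    ⟨ht, hs.2.mono (Finset.coe_subset.2 hts)⟩⟩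
  singleton_mem v := ⟨Finset.singleton_nonempty v, by simp⟩

/-- The upper Dowker complex of a poset: the simplices are the nonempty finite sets which have an
upper bound. -/
def upperDowkerComplex (P : Type u) [PartialOrder P] : AbstractSimplicialComplex P where
  faces := {s | s.Nonempty ∧ ∃ y, ∀ x ∈ s, x ≤ y}
  isRelLowerSet_faces := fun _ hs => ⟨hs.1, fun _ hts ht => ⟨ht,
    hs.2.imp fun _ hy x hx => hy x (hts hx)⟩⟩
  singleton_mem v := ⟨Finset.singleton_nonempty v, v, by simp⟩

/-- The lower Dowker complex of a poset: the simplices are the nonempty finite sets which have a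
lower bound. -/
def lowerDowkerComplex (P : Type u) [PartialOrder P] : AbstractSimplicialComplex P where
  faces := {s | s.Nonempty ∧ ∃ x, ∀ y ∈ s, x ≤ y}
  isRelLowerSet_faces := fun _ hs => ⟨hs.1, fun _ hts ht => ⟨ht,
    hs.2.imp fun _ hx y hy => hx y (hts hy)⟩⟩
  singleton_mem v := ⟨Finset.singleton_nonempty v, v, by simp⟩

/-- The simplicial map of McCord complexes induced by a monotone map. -/
def mcCordMap {P Q : Type u} [PartialOrder P] [PartialOrder Q] (f : P →o Q) :
    SimplicialMap (mcCordComplex P) (mcCordComplex Q) where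
  toFun := f
  map_faces s hs t ht := by
    refine ⟨?_, ?_⟩
    · exact nonempty_of_coe_eq_image hs.1 ht
    · rw [ht]
      exact hs.2.image_of_map_rel _ _ _ fun _ _ h => f.monotone h

/-- The simplicial map of upper Dowker complexes induced by a monotone map. -/
def upperDowkerMap {P Q : Type u} [PartialOrder P] [PartialOrder Q] (f : P →o Q) :
    SimplicialMap (upperDowkerComplex P) (upperDowkerComplex Q) where
  toFun := f
  map_faces s hs t ht := by
    refine ⟨?_, ?_⟩
    · exact nonempty_of_coe_eq_image hs.1 ht
    · obtain ⟨y, hy⟩ := hs.2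
      refine ⟨f y, fun z hz => ?_⟩
      rw [← Finset.mem_coe, ht] at hz
      obtain ⟨x, hx, rfl⟩ := hz
      exact f.monotone (hy x hx)

/-- The simplicial map of lower Dowker complexes induced by a monotone map. -/
def lowerDowkerMap {P Q : Type u} [PartialOrder P] [PartialOrder Q] (f : P →o Q) :
    SimplicialMap (lowerDowkerComplex P) (lowerDowkerComplex Q) where
  toFun := f
  map_faces s hs t ht := by
    refine ⟨?_, ?_⟩
    · exact nonempty_of_coe_eq_image hs.1 ht
    · obtain ⟨y, hy⟩ := hs.2
      refine ⟨f y, fun z hz => ?_⟩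
      rw [← Finset.mem_coe, ht] at hz
      obtain ⟨x, hx, rfl⟩ := hz
      exact f.monotone (hy x hx)

/-! ## Adjusted approximative sequences -/

/-- An adjusted approximative sequence `{ε_n, A_n}` of `X`: positive real numbers `ε_n` decreasing
to zero and finite `ε_n`-approximations `A_n` of `X` with `ε_{n+1} < (ε_n - γ_n) / 2`, where
`γ_n = sup {d(x, A_n) : x ∈ X}`. -/
structure AdjustedSequence (X : Type u) [MetricSpace X] where
  ε : ℕ → ℝ
  A : ℕ → Finset X
  pos : ∀ n, 0 < ε n
  anti : Antitone ε
  tendsto_zero : Filter.Tendsto ε Filter.atTop (𝓝 0)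
  approx : ∀ n (x : X), ∃ a ∈ A n, dist x a < ε n
  adjusted : ∀ n, ε (n + 1) < (ε n - ⨆ x : X, Metric.infDist x (A n : Set X)) / 2

namespace AdjustedSequence

variable {X : Type u} [MetricSpace X] (D : AdjustedSequence X)

/-- The number `γ_n = sup {d(x, A_n) : x ∈ X}`. -/
def γ (n : ℕ) : ℝ := ⨆ x : X, Metric.infDist x (D.A n : Set X)

/-- The set `q_{A_n}(x)` of the points of `A_n` nearest to `x`. -/
def near (n : ℕ) (x : X) : Set X := {a | a ∈ D.A n ∧ Metric.infDist x (D.A n : Set X) = dist x a}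

theorem near_nonempty (n : ℕ) (x : X) : (D.near n x).Nonempty := by
  obtain ⟨b, hb, _⟩ := D.approx n x
  obtain ⟨a, ha, h⟩ := (D.A n).finite_toSet.isCompact.exists_infDist_eq_dist ⟨b, hb⟩ x
  exact ⟨a, ha, h⟩

theorem dist_le_of_mem_near [CompactSpace X] {n : ℕ} {x a : X} (h : a ∈ D.near n x) :
    dist x a ≤ D.γ n := by
  rw [← h.2]
  have hb : BddAbove (Set.range fun x : X => Metric.infDist x (D.A n : Set X)) :=
    (isCompact_range (Metric.continuous_infDist_pt _)).bddAbove
  exact le_ciSup hb x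

theorem two_mul_add_lt (n : ℕ) : 2 * D.ε (n + 1) + D.γ n < D.ε n := by
  have h := D.adjusted n
  change _ < (D.ε n - D.γ n) / 2 at h
  linarith

/-- The poset `U_{2ε_n}(A_n)`, ordered by inclusion, of the nonempty subsets of `A_n` of diameter
`< 2ε_n`. -/
abbrev U (n : ℕ) : Type u :=
  {C : Set X // C.Nonempty ∧ C ⊆ (D.A n : Set X) ∧ Metric.diam C < 2 * D.ε n}

theorem diam_lt [CompactSpace X] {n : ℕ} {C E : Set X} (hC : Metric.diam C < 2 * D.ε (n + 1))
    (hE : ∀ b ∈ E, ∃ a ∈ C, b ∈ D.near n a) : Metric.diam E < 2 * D.ε n := by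
  have h0 := D.pos (n + 1)
  have h1 := D.two_mul_add_lt n
  have hγ : 0 ≤ D.γ n := Real.iSup_nonneg fun _ => Metric.infDist_nonneg
  refine lt_of_le_of_lt (Metric.diam_le_of_forall_dist_le
    (C := 2 * D.γ n + 2 * D.ε (n + 1)) (by positivity) ?_) (by linarith)
  intro b hb b' hb'
  obtain ⟨a, ha, hab⟩ := hE b hb
  obtain ⟨a', ha', hab'⟩ := hE b' hb'
  have h2 := D.dist_le_of_mem_near hab
  have h3 := D.dist_le_of_mem_near hab'
  have h4 := Metric.dist_le_diam_of_mem (isCompact_univ.isBounded.subset (Set.subset_univ C)) ha ha'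
  have h5 := dist_triangle4 b a a' b'
  rw [dist_comm b a] at h5
  linarith

/-- The map `p_{n,n+1} : U_{2ε_{n+1}}(A_{n+1}) → U_{2ε_n}(A_n)`, sending `C` to the union of the
sets `q_{A_n}(c)`, `c ∈ C`. -/
def p [CompactSpace X] (n : ℕ) : D.U (n + 1) →o D.U n where
  toFun C := ⟨⋃ c ∈ C.1, D.near n c, by
    obtain ⟨C, ⟨c, hc⟩, -, hd⟩ := C
    refine ⟨?_, ?_, ?_⟩
    · obtain ⟨a, ha⟩ := D.near_nonempty n c
      exact ⟨a, Set.mem_biUnion hc ha⟩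
    · exact Set.iUnion₂_subset fun c _ a ha => ha.1
    · exact D.diam_lt hd fun b hb => by simpa using hb⟩
  monotone' _ _ h := Set.biUnion_subset_biUnion_left h

/-- The Alexandroff–McCord approximative sequence. -/
def alexandroffMcCord [CompactSpace X] : InverseSystem.{w} HTop.{u} :=
  polyhedralSequence (fun n => mcCordComplex (D.U n)) (fun n => mcCordMap (D.p n))

/-- The upper Dowker approximative sequence. -/
def upperDowker [CompactSpace X] : InverseSystem.{w} HTop.{u} :=
  polyhedralSequence (fun n => upperDowkerComplex (D.U n)) (fun n => upperDowkerMap (D.p n))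

/-- The lower Dowker approximative sequence. -/
def lowerDowker [CompactSpace X] : InverseSystem.{w} HTop.{u} :=
  polyhedralSequence (fun n => lowerDowkerComplex (D.U n)) (fun n => lowerDowkerMap (D.p n))

/-- A choice of a nearest point `r n a ∈ q_{A_n}(a)` for every `n` and every `a ∈ A_{n+1}`. -/
def IsNearestChoice (r : ∀ n, D.A (n + 1) → D.A n) : Prop :=
  ∀ n (a : D.A (n + 1)), (r n a : X) ∈ D.near n a

/-- The Vietoris–Rips complexes `R_{2ε_n}(A_n)`. -/
def rips (n : ℕ) : AbstractSimplicialComplex (D.A n) :=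
  ripsComplex (D.A n) (2 * D.ε n) (mul_pos two_pos (D.pos n))

/-- The map `R_{2ε_{n+1}}(A_{n+1}) → R_{2ε_n}(A_n)`, sending `a` to the chosen point of
`q_{A_n}(a)`. -/
def ripsMap [CompactSpace X] {r : ∀ n, D.A (n + 1) → D.A n} (hr : D.IsNearestChoice r) (n : ℕ) :
    SimplicialMap (D.rips (n + 1)) (D.rips n) where
  toFun := r n
  map_faces s hs t ht := by
    refine ⟨?_, ?_⟩
    · exact nonempty_of_coe_eq_image hs.1 ht
    · have hs2 : Metric.diam (s : Set (D.A (n + 1))) < 2 * D.ε (n + 1) := hs.2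
      rw [← isometry_subtype_coe.diam_image] at hs2 ⊢
      refine D.diam_lt hs2 ?_
      rw [ht]
      rintro _ ⟨_, ⟨a, ha, rfl⟩, rfl⟩
      exact ⟨a, ⟨a, ha, rfl⟩, hr n a⟩

/-- The Vietoris–Rips approximative sequence. -/
def ripsSequence [CompactSpace X] {r : ∀ n, D.A (n + 1) → D.A n} (hr : D.IsNearestChoice r) :
    InverseSystem.{w} HTop.{u} :=
  polyhedralSequence D.rips (D.ripsMap hr)

/-- The witness complex `W_n`: the simplices are the nonempty finite sets of points of `A_n` such
that every nonempty subset `{a_0, …, a_r}` of them has a witness, i.e. a point `x ∈ X` with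
`∑ d(x, a_j) < (r + 1) ε_n`. -/
def witness (n : ℕ) : AbstractSimplicialComplex (D.A n) where
  faces := {s | s.Nonempty ∧ ∀ t ⊆ s, t.Nonempty →
    ∃ x : X, ∑ a ∈ t, dist x (a : X) < t.card * D.ε n}
  isRelLowerSet_faces := fun _ hs => ⟨hs.1, fun _ hts ht => ⟨ht,
    fun t' ht' => hs.2 t' (ht'.trans hts)⟩⟩
  singleton_mem v := by
    refine ⟨Finset.singleton_nonempty v, fun t ht ht' => ⟨v, ?_⟩⟩
    obtain rfl := (Finset.Nonempty.subset_singleton_iff ht').1 ht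
    simpa using D.pos n

/-- The map `ω_{n,n+1} : W_{n+1} → W_n`, sending `a` to the chosen point of `q_{A_n}(a)`. -/
def witnessMap [CompactSpace X] {r : ∀ n, D.A (n + 1) → D.A n} (hr : D.IsNearestChoice r)
    (n : ℕ) : SimplicialMap (D.witness (n + 1)) (D.witness n) where
  toFun := r n
  map_faces s hs t ht := by
    classical
    refine ⟨?_, fun t' ht' hne => ?_⟩
    · exact nonempty_of_coe_eq_image hs.1 ht
    · have hsub : (t' : Set (D.A n)) ⊆ r n '' (s : Set (D.A (n + 1))) := by
        rw [← ht]
        exact Finset.coe_subset.2 ht'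
      obtain ⟨s', hs', hinj, himg⟩ := Finset.exists_subset_injOn_image_eq_of_surjOn
        (s : Set (D.A (n + 1))) t' hsub
      subst himg
      obtain ⟨x, hx⟩ := hs.2 s' (Finset.coe_subset.1 hs') (Finset.image_nonempty.1 hne)
      refine ⟨x, ?_⟩
      rw [Finset.sum_image hinj, Finset.card_image_of_injOn hinj]
      have h1 : ∀ a ∈ s', dist x (r n a : X) ≤ dist x (a : X) + D.γ n := fun a _ =>
        (dist_triangle _ (a : X) _).trans
          (by linarith [D.dist_le_of_mem_near (hr n a)])
      have h2 := Finset.sum_le_sum h1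
      rw [Finset.sum_add_distrib, Finset.sum_const, nsmul_eq_mul] at h2
      have h3 := D.two_mul_add_lt n
      have h4 := D.pos (n + 1)
      have h5 : (s'.card : ℝ) * (D.ε (n + 1) + D.γ n) ≤ s'.card * D.ε n :=
        mul_le_mul_of_nonneg_left (by linarith) (Nat.cast_nonneg _)
      linarith

/-- The witness approximative sequence. -/
def witnessSequence [CompactSpace X] {r : ∀ n, D.A (n + 1) → D.A n} (hr : D.IsNearestChoice r) :
    InverseSystem.{w} HTop.{u} :=
  polyhedralSequence D.witness (D.witnessMap hr)

/-- The covering `B_n` of `X` by the open balls of radius `ε_n` with centers in `A_n`. -/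
def cover (n : ℕ) : Set (Set X) := {B | ∃ a ∈ D.A n, B = Metric.ball a (D.ε n)}

/-- The nerve of the covering `B_n`. -/
def cechNerve (n : ℕ) : AbstractSimplicialComplex (D.cover n) :=
  nerve (D.cover n) fun _ hB => by
    obtain ⟨a, -, rfl⟩ := hB
    exact ⟨a, Metric.mem_ball_self (D.pos n)⟩

/-- A choice, for every `n` and every member of `B_{n+1}`, written as a ball `B(a, ε_{n+1})` with
`a ∈ A_{n+1}`, of a ball `B(b, ε_n)` with `b ∈ q_{A_n}(a)`. -/
def IsNearestBallChoice (r : ∀ n, D.cover (n + 1) → D.cover n) : Prop :=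
  ∀ n (B : D.cover (n + 1)), ∃ a ∈ D.A (n + 1), (B : Set X) = Metric.ball a (D.ε (n + 1)) ∧
    ∃ b ∈ D.near n a, (r n B : Set X) = Metric.ball b (D.ε n)

/-- The map `N(B_{n+1}) → N(B_n)`, sending a ball of `B_{n+1}` to the chosen ball of `B_n`. -/
def cechMap [CompactSpace X] {r : ∀ n, D.cover (n + 1) → D.cover n}
    (hr : D.IsNearestBallChoice r) (n : ℕ) :
    SimplicialMap (D.cechNerve (n + 1)) (D.cechNerve n) where
  toFun := r n
  map_faces s hs t ht := by
    refine ⟨?_, ?_⟩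
    · exact nonempty_of_coe_eq_image hs.1 ht
    · obtain ⟨x, hx⟩ := hs.2
      refine ⟨x, fun E hE => ?_⟩
      rw [← Finset.mem_coe, ht] at hE
      obtain ⟨B, hB, rfl⟩ := hE
      obtain ⟨a, -, hBa, b, hb, hrb⟩ := hr n B
      have h1 := hx B hB
      rw [hBa, Metric.mem_ball] at h1
      rw [hrb, Metric.mem_ball]
      have h2 := D.dist_le_of_mem_near hb
      have h3 := D.two_mul_add_lt n
      have h4 := D.pos (n + 1)
      linarith [dist_triangle x a b]

/-- The Čech approximative sequence. -/
def cechSequence [CompactSpace X] {r : ∀ n, D.cover (n + 1) → D.cover n}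
    (hr : D.IsNearestBallChoice r) : InverseSystem.{w} HTop.{u} :=
  polyhedralSequence D.cechNerve (D.cechMap hr)

end AdjustedSequence

end PolyhedralShape

end

/-! A sequence of finite complexes is an expansion of `X` as soon as it carries the data of
`Approximation`: vertices have positions in `X`, the vertices near a point span a simplex, and one
bonding map takes every simplex to vertices near a single point. Partitions of unity then give maps
`X → |K n|`, and `Approximation.isHPolExpansion` proves both halves of the universal property. A map
`X → |L|` is evaluated at the positions of the vertices of a fine `K (m + 1)` and interpolated. If
`g` and `g'` become homotopic on `X`, the homotopy is interpolated in the same way, and its ends are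
homotopic to `g` and `g'` composed with a bonding map.

Values at neighbouring vertices need not lie in a common simplex of `L`, so linear interpolation is
not available. In `exists_truncated_extension` the barycentric coordinates below some `δ` are
discarded first; what remains at positions close to `x` is supported in the carrier of the value at
`x`. Homotopies are straight lines between maps with values in common simplices
(`homotopic_of_common_face`), and compactness reduces the weak topology to finitely many
coordinates.

The Čech, witness, Vietoris–Rips and upper Dowker sequences are approximations because `2ε_{n+1} +
γ_n < ε_n`: points within `2ε_{n+1}` of a centre move to points within `ε_n` of it. The McCord
complexes are treated differently, since elements of `X_n` near a point need not form a chain.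
Bounded families in `X_n` have suprema (unions), so the inclusion of the McCord complex in the upper
Dowker complex is a homotopy equivalence (`exists_iso_mcCord_upperDowker`); its inverse sends a
point to a combination of suprema of superlevel sets of its coordinates. Reversing the order, with
intersections as suprema, yields the lower Dowker sequence. -/

noncomputable section

namespace PolyhedralShape

/-! ## Continuous maps into realizations -/

section Realization

variable {V : Type u} {K : AbstractSimplicialComplex V}

theorem ClosedSimplex.continuous_coord {s : Finset V} (v : V) :
    Continuous fun x : ClosedSimplex K s => x.1.1 v :=
  (continuous_apply v).comp continuous_induced_dom

instance ClosedSimplex.t2Space (s : Finset V) : T2Space (ClosedSimplex K s) :=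
  T2Space.of_injective_continuous (f := fun x (v : V) => x.1.1 v)
    (fun _ _ h => Subtype.ext (Subtype.ext (DFunLike.coe_injective h))) continuous_induced_dom

theorem ClosedSimplex.continuous_val {s : Finset V} (hs : s ∈ K.faces) :
    Continuous fun x : ClosedSimplex K s => x.1 := by
  rw [continuous_iff_coinduced_le]
  exact le_iSup (fun t : K.faces => TopologicalSpace.coinduced
    (fun y : ClosedSimplex K (t : Finset V) => y.1) inferInstance) ⟨_, hs⟩

namespace Realization

theorem nonneg (x : Realization K) (v : V) : 0 ≤ x.1 v := x.2.1 v

theorem support_mem (x : Realization K) : x.1.support ∈ K.faces := x.2.2.1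

theorem sum_eq_one (x : Realization K) {S : Finset V} (h : x.1.support ⊆ S) :
    ∑ v ∈ S, x.1 v = 1 :=
  (Finsupp.sum_of_support_subset x.1 h (fun _ r => r) fun _ _ => rfl).symm.trans x.2.2.2

theorem mem_support_iff (x : Realization K) (v : V) : v ∈ x.1.support ↔ 0 < x.1 v := by
  rw [Finsupp.mem_support_iff]
  exact ⟨fun h => lt_of_le_of_ne (x.nonneg v) h.symm, fun h => h.ne'⟩

theorem exists_pos (x : Realization K) : ∃ v, 0 < x.1 v := by
  obtain ⟨v, hv⟩ := (K.isRelLowerSet_faces x.support_mem).1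
  exact ⟨v, (x.mem_support_iff v).1 hv⟩

theorem ext_coord {x y : Realization K} (h : ∀ v, x.1 v = y.1 v) : x = y :=
  Subtype.ext (Finsupp.ext h)

theorem continuous_coord (v : V) : Continuous fun x : Realization K => x.1 v := by
  rw [continuous_iSup_dom]
  rintro ⟨s, hs⟩
  rw [continuous_coinduced_dom]
  exact ClosedSimplex.continuous_coord v

/-- A map with values in a finite subcomplex is continuous if its coordinates are. -/
theorem continuous_of_coord {Z : Type*} [TopologicalSpace Z] {g : Z → Realization K}
    (S : Finset V) (hS : ∀ z, (g z).1.support ⊆ S)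
    (hg : ∀ v ∈ S, Continuous fun z => (g z).1 v) : Continuous g := by
  classical
  have hg' : ∀ v, Continuous fun z => (g z).1 v := by
    intro v
    by_cases hv : v ∈ S
    · exact hg v hv
    · have : (fun z => (g z).1 v) = fun _ => 0 := by
        funext z
        by_contra h
        exact hv (hS z (Finsupp.mem_support_iff.2 h))
      rw [this]
      exact continuous_const
  -- The simplices inside `S` give a finite closed cover of `Z`. On each member the map factors
  -- through one closed simplex, whose topology is that of the coordinates.
  let F : {s : Finset V // s ∈ K.faces ∧ s ⊆ S} → Set Z := fun s => {z | (g z).1.support ⊆ s.1}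
  have hfin : Finite {s : Finset V // s ∈ K.faces ∧ s ⊆ S} :=
    Set.Finite.to_subtype ((S.powerset.finite_toSet).subset fun s hs => by
      simpa using hs.2)
  refine (locallyFinite_of_finite F).continuous ?_ ?_ ?_
  · refine Set.eq_univ_of_forall fun z => Set.mem_iUnion.2 ⟨⟨_, (g z).support_mem, hS z⟩, ?_⟩
    exact Finset.Subset.refl _
  · rintro ⟨s, hs, -⟩
    have : F ⟨s, hs, ‹_›⟩ = ⋂ v ∈ {v | v ∉ s}, {z | (g z).1 v = 0} := by
      ext z
      simp only [F, Set.mem_ofPred_eq, Set.mem_iInter]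
      refine ⟨fun h v hv => by_contra fun h' => hv (h (Finsupp.mem_support_iff.2 h')),
        fun h v hv => by_contra fun h' => Finsupp.mem_support_iff.1 hv (h v h')⟩
    rw [this]
    exact isClosed_biInter fun v _ => isClosed_eq (hg' v) continuous_const
  · rintro ⟨s, hs, -⟩
    rw [continuousOn_iff_continuous_domRestrict]
    let k : F ⟨s, hs, ‹_›⟩ → ClosedSimplex K s := fun z => ⟨g z.1, z.2⟩
    have hk : Continuous k := by
      rw [continuous_induced_rng, continuous_pi_iff]
      exact fun v => (hg' v).comp continuous_subtype_val
    exact (ClosedSimplex.continuous_val hs).comp hk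

/-- A compact subset of a realization lies in a finite subcomplex. -/
theorem exists_support_subset {Z : Type*} [TopologicalSpace Z] [CompactSpace Z]
    (g : C(Z, Realization K)) : ∃ S : Finset V, ∀ z, (g z).1.support ⊆ S := by
  classical
  let carr : Set (Finset V) := Set.range fun z => (g z).1.support
  suffices h : carr.Finite by
    refine ⟨h.toFinset.biUnion id, fun z v hv => ?_⟩
    rw [Finset.mem_biUnion]
    exact ⟨(g z).1.support, by simp [carr], hv⟩
  -- One point of the image is chosen for each carrier. These points form a closed discrete subset
  -- of a compact set, hence a finite one.
  choose pt hpt using fun s : carr => s.2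
  let d : carr → Realization K := fun s => g (pt s)
  have hd : ∀ s, (d s).1.support = s.1 := hpt
  have hinj : Function.Injective d := fun s t h => Subtype.ext (by rw [← hd, ← hd, h])
  -- Chosen points have distinct supports and those in a closed simplex are supported on subsets of
  -- `s`, so every set of chosen points meets it in a finite, thus closed, set.
  have hclosed : ∀ A : Set (Realization K), A ⊆ Set.range d → IsClosed A := by
    intro A hA
    rw [isClosed_iff]
    intro s _
    refine Set.Finite.isClosed (Set.Finite.of_injOn (f := fun x => x.1.1.support)
      (t := (s.powerset : Set (Finset V))) (fun x _ => ?_) ?_ s.powerset.finite_toSet)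
    · simpa using x.2
    · intro x hx y hy hxy
      obtain ⟨s, hs⟩ := hA hx
      obtain ⟨t, ht⟩ := hA hy
      refine Subtype.ext ?_
      rw [← hs, ← ht]
      congr 1
      refine Subtype.ext ?_
      rw [← hd s, ← hd t, hs, ht]
      exact hxy
  have hdisc : DiscreteTopology (Set.range d) := by
    rw [discreteTopology_iff_forall_isClosed]
    intro A
    have := hclosed (Subtype.val '' A) (by rintro _ ⟨x, _, rfl⟩; exact x.2)
    rw [← Set.preimage_image_eq A Subtype.val_injective]
    exact this.preimage continuous_subtype_val
  have hcomp : IsCompact (Set.range d) :=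
    (isCompact_range g.continuous).of_isClosed_subset (hclosed _ subset_rfl)
      (by rintro _ ⟨s, rfl⟩; exact ⟨_, rfl⟩)
  have : CompactSpace (Set.range d) := isCompact_iff_compactSpace.1 hcomp
  have : Finite (Set.range d) := finite_of_compact_of_discrete
  have : Finite carr := Finite.of_injective (fun s => (⟨d s, s, rfl⟩ : Set.range d))
    fun s t h => hinj (congrArg Subtype.val h)
  exact Set.toFinite carr

/-- Continuous nonnegative weights, the nonvanishing ones of which span a simplex at every point,
define a continuous map to the realization. -/
theorem exists_continuousMap_of_weights {Z : Type*} [TopologicalSpace Z] (S : Finset V)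
    (ω : V → Z → ℝ) (hc : ∀ v ∈ S, Continuous (ω v)) (h0 : ∀ v ∈ S, ∀ z, 0 ≤ ω v z)
    (hpos : ∀ z, ∃ v ∈ S, 0 < ω v z)
    (hface : ∀ z, ∃ T ∈ K.faces, ∀ v ∈ S, 0 < ω v z → v ∈ T) :
    ∃ g : C(Z, Realization K), ∀ z, (∀ v ∈ S, (g z).1 v = ω v z / ∑ u ∈ S, ω u z) ∧
      ∀ v ∉ S, (g z).1 v = 0 := by
  classical
  have hsum : ∀ z, 0 < ∑ u ∈ S, ω u z := fun z => by
    obtain ⟨v, hv, hvz⟩ := hpos z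
    exact Finset.sum_pos' (fun u hu => h0 u hu z) ⟨v, hv, hvz⟩
  let y : Z → V →₀ ℝ := fun z => Finsupp.onFinset S
    (fun v => if v ∈ S then ω v z / ∑ u ∈ S, ω u z else 0) (fun v hv => by
      by_contra h
      simp [h] at hv)
  have hy : ∀ z v, y z v = if v ∈ S then ω v z / ∑ u ∈ S, ω u z else 0 := fun _ _ => rfl
  have hsub : ∀ z, (y z).support ⊆ S := fun z => Finsupp.support_onFinset_subset
  have hone : ∀ z, ((y z).sum fun _ r => r) = 1 := fun z => by
    rw [Finsupp.sum_of_support_subset _ (hsub z) _ (fun _ _ => rfl)]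
    rw [Finset.sum_congr rfl fun v hv => (hy z v).trans (if_pos hv), ← Finset.sum_div]
    exact div_self (hsum z).ne'
  have hmem : ∀ z, (y z).support ∈ K.faces := fun z => by
    obtain ⟨T, hT, hTz⟩ := hface z
    refine (K.isRelLowerSet_faces hT).2 (fun v hv => ?_) ?_
    · have hvS := hsub z hv
      refine hTz v hvS (lt_of_le_of_ne (h0 v hvS z) fun h => ?_)
      rw [Finsupp.mem_support_iff, hy, if_pos hvS, ← h, zero_div] at hv
      exact hv rfl
    · rw [Finset.nonempty_iff_ne_empty]
      intro h
      rw [Finsupp.support_eq_empty] at h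
      have := hone z
      simp [h] at this
  have hnn : ∀ z v, 0 ≤ y z v := fun z v => by
    rw [hy]
    split_ifs with h
    · exact div_nonneg (h0 v h z) (hsum z).le
    · exact le_rfl
  refine ⟨⟨fun z => ⟨y z, hnn z, hmem z, hone z⟩, continuous_of_coord S hsub fun v hv => ?_⟩,
    fun z => ⟨fun v hv => (hy z v).trans (if_pos hv), fun v hv => (hy z v).trans (if_neg hv)⟩⟩
  change Continuous fun z => y z v
  simp only [hy, if_pos hv]
  exact (hc v hv).div (continuous_finsetSum _ fun u hu => hc u hu) fun z => (hsum z).ne'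

theorem pos_of_weights {Z : Type*} [TopologicalSpace Z] {S : Finset V} {ω : V → Z → ℝ}
    {g : C(Z, Realization K)} {z : Z} (h0 : ∀ v ∈ S, 0 ≤ ω v z)
    (hg : (∀ v ∈ S, (g z).1 v = ω v z / ∑ u ∈ S, ω u z) ∧ ∀ v ∉ S, (g z).1 v = 0) {v : V}
    (hv : 0 < (g z).1 v) : v ∈ S ∧ 0 < ω v z := by
  by_cases h : v ∈ S
  · refine ⟨h, lt_of_le_of_ne (h0 v h) fun e => ?_⟩
    rw [hg.1 v h, ← e, zero_div] at hv
    exact hv.false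
  · rw [hg.2 v h] at hv
    exact hv.false.elim

/-- Two maps such that the values at any point lie in a common simplex are homotopic. -/
theorem homotopic_of_common_face {Z : Type*} [TopologicalSpace Z] [CompactSpace Z]
    (g g' : C(Z, Realization K))
    (h : ∀ z, ∃ T ∈ K.faces, ∀ v, (0 < (g z).1 v → v ∈ T) ∧ (0 < (g' z).1 v → v ∈ T)) :
    g.Homotopic g' := by
  classical
  obtain ⟨S₁, hS₁⟩ := exists_support_subset g
  obtain ⟨S₂, hS₂⟩ := exists_support_subset g'
  let S := S₁ ∪ S₂
  have hS : ∀ z, (g z).1.support ⊆ S := fun z => (hS₁ z).trans Finset.subset_union_left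
  have hS' : ∀ z, (g' z).1.support ⊆ S := fun z => (hS₂ z).trans Finset.subset_union_right
  -- The straight-line homotopy. Its continuity can be tested on coordinates because both maps take
  -- values in the finite subcomplex on `S`.
  let ω : V → unitInterval × Z → ℝ := fun v p => (1 - p.1.1) * (g p.2).1 v + p.1.1 * (g' p.2).1 v
  have hc : ∀ v, Continuous (ω v) := fun v => by
    have h1 : Continuous fun p : unitInterval × Z => (g p.2).1 v :=
      (continuous_coord v).comp (g.continuous.comp continuous_snd)
    have h2 : Continuous fun p : unitInterval × Z => (g' p.2).1 v :=
      (continuous_coord v).comp (g'.continuous.comp continuous_snd)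
    fun_prop
  have h0 : ∀ v p, 0 ≤ ω v p := fun v p => add_nonneg
    (mul_nonneg (sub_nonneg.2 p.1.2.2) (nonneg _ _)) (mul_nonneg p.1.2.1 (nonneg _ _))
  have hsum : ∀ p, ∑ v ∈ S, ω v p = 1 := fun p => by
    rw [Finset.sum_add_distrib, ← Finset.mul_sum, ← Finset.mul_sum, sum_eq_one _ (hS _),
      sum_eq_one _ (hS' _)]
    ring
  obtain ⟨G, hG⟩ := exists_continuousMap_of_weights (K := K) S ω (fun v _ => hc v)
    (fun v _ => h0 v) (fun p => by
      by_contra! hcon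
      have := Finset.sum_nonpos hcon
      rw [hsum] at this
      linarith) (fun p => by
      obtain ⟨T, hT, hTz⟩ := h p.2
      refine ⟨T, hT, fun v _ hv => ?_⟩
      by_contra hvT
      have h1 : (g p.2).1 v = 0 := le_antisymm (not_lt.1 fun h => hvT ((hTz v).1 h)) (nonneg _ _)
      have h2 : (g' p.2).1 v = 0 := le_antisymm (not_lt.1 fun h => hvT ((hTz v).2 h)) (nonneg _ _)
      simp [ω, h1, h2] at hv)
  have hend : ∀ (f : C(Z, Realization K)) (p : unitInterval × Z) (z : Z),
      (f z).1.support ⊆ S → (∀ v, ω v p = (f z).1 v) → G p = f z := by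
    intro f p z hf hω
    refine ext_coord fun v => ?_
    by_cases hv : v ∈ S
    · rw [(hG p).1 v hv, hsum, hω, div_one]
    · rw [(hG p).2 v hv]
      by_contra hne
      exact hv (hf (Finsupp.mem_support_iff.2 (Ne.symm hne)))
  exact ⟨⟨G, fun z => hend g _ z (hS z) fun v => by simp [ω],
    fun z => hend g' _ z (hS' z) fun v => by simp [ω]⟩⟩

variable (K) in
-- Finitely many closed simplices cover `|K|`, and each is the continuous image of a compact face of
-- the standard simplex.
theorem compactSpace_of_finite [Finite V] : CompactSpace (Realization K) := by
  classical
  have : Fintype V := Fintype.ofFinite V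
  let Δ : Set (V → ℝ) := {x | (∀ v, 0 ≤ x v) ∧ ∑ v, x v = 1}
  have hΔ : IsCompact Δ := isCompact_stdSimplex ℝ V
  let e : Realization K → V → ℝ := fun x v => x.1 v
  have hcl : ∀ s ∈ K.faces, IsCompact {x ∈ Δ | ∀ v ∉ s, x v = 0} := fun s _ => by
    refine hΔ.of_isClosed_subset ?_ (Set.sep_subset _ _)
    have : {x ∈ Δ | ∀ v ∉ s, x v = 0} = Δ ∩ ⋂ v ∈ {v | v ∉ s}, {x | x v = 0} := by
      ext x
      simp
    rw [this]
    exact hΔ.isClosed.inter (isClosed_biInter fun v _ =>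
      isClosed_eq (continuous_apply v) continuous_const)
  refine ⟨?_⟩
  have hcov : (Set.univ : Set (Realization K)) =
      ⋃ s ∈ K.faces, {x : Realization K | x.1.support ⊆ s} := by
    refine (Set.eq_univ_of_forall fun x => ?_).symm
    exact Set.mem_biUnion x.support_mem (Finset.Subset.refl x.1.support)
  rw [hcov]
  refine (Set.toFinite K.faces).isCompact_biUnion fun s hs => ?_
  have : CompactSpace {x // x ∈ Δ ∧ ∀ v ∉ s, x v = 0} := isCompact_iff_compactSpace.1 (hcl s hs)
  obtain ⟨g, hg⟩ := exists_continuousMap_of_weights (K := K)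
    (Z := {x // x ∈ Δ ∧ ∀ v ∉ s, x v = 0}) Finset.univ (fun v x => x.1 v)
    (fun v _ => (continuous_apply v).comp continuous_subtype_val) (fun v _ x => x.2.1.1 v)
    (fun x => by
      by_contra! hcon
      have := Finset.sum_nonpos hcon
      rw [x.2.1.2] at this
      linarith)
    (fun x => ⟨s, hs, fun v _ hv => by
      by_contra h
      rw [x.2.2 v h] at hv
      exact hv.false⟩)
  have hr : {x : Realization K | x.1.support ⊆ s} = Set.range g := by
    ext x
    constructor
    · intro hx
      refine ⟨⟨e x, ⟨x.nonneg, x.sum_eq_one (Finset.subset_univ _)⟩, fun v hv => ?_⟩, ?_⟩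
      · by_contra h
        exact hv (hx (Finsupp.mem_support_iff.2 h))
      · refine ext_coord fun v => ?_
        exact ((hg _).1 v (Finset.mem_univ v)).trans ((congrArg (x.1 v / ·)
          (x.sum_eq_one (Finset.subset_univ _))).trans (div_one _))
    · rintro ⟨z, rfl⟩ v hv
      by_contra h
      rw [Finsupp.mem_support_iff, (hg z).1 v (Finset.mem_univ v), z.2.2 v h, zero_div] at hv
      exact hv rfl
  rw [hr]
  exact isCompact_range g.continuous

/-- Uniform continuity, in terms of coordinates, of maps on the realization of a finite complex. -/
theorem exists_uniform_modulus [Finite V] {E : Type*} [PseudoMetricSpace E] {F : Realization K → E}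
    (hF : Continuous F) {δ : ℝ} (hδ : 0 < δ) :
    ∃ η > 0, ∀ x y : Realization K, (∀ v, |x.1 v - y.1 v| < η) → dist (F x) (F y) < δ := by
  have : Fintype V := Fintype.ofFinite V
  have := compactSpace_of_finite K
  let e : Realization K → V → ℝ := fun x v => x.1 v
  -- A continuous injection of a compact space into a Hausdorff one: the weak topology is that of
  -- the coordinates, and the sup metric induces it.
  have he : IsClosedEmbedding e := Continuous.isClosedEmbedding
    (continuous_pi fun v => continuous_coord v) fun x y h => ext_coord fun v => congrFun h v
  let _ := he.isEmbedding.comapMetricSpace e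
  have hu : UniformContinuous F := CompactSpace.uniformContinuous_of_continuous hF
  obtain ⟨η, hη, H⟩ := Metric.uniformContinuous_iff.1 hu δ hδ
  refine ⟨η, hη, fun x y hxy => H ?_⟩
  change dist (e x) (e y) < η
  rw [dist_pi_lt_iff hη]
  exact hxy

end Realization

theorem SimplicialMap.realization_pos {W : Type v} {L : AbstractSimplicialComplex W}
    (f : SimplicialMap K L) {x : Realization K} {w : W} (h : 0 < (f.realization x).1 w) :
    ∃ v, 0 < x.1 v ∧ f.toFun v = w := by
  classical
  have h1 : w ∈ (f.realization x).1.support := (Realization.mem_support_iff _ _).2 h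
  have h2 := Finsupp.mapDomain_support h1
  rw [Finset.mem_image] at h2
  obtain ⟨v, hv, rfl⟩ := h2
  exact ⟨v, (x.mem_support_iff v).1 hv, rfl⟩

theorem SimplicialMap.map_mem {W : Type v} [DecidableEq W] {L : AbstractSimplicialComplex W}
    (f : SimplicialMap K L) {s : Finset V} (hs : s ∈ K.faces) : s.image f.toFun ∈ L.faces :=
  f.map_faces s hs _ (by simp)

/-- The identity simplicial map. -/
def SimplicialMap.id (K : AbstractSimplicialComplex V) : SimplicialMap K K where
  toFun := _root_.id
  map_faces s hs t ht := by
    rw [Set.image_id, Finset.coe_inj] at ht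
    exact ht ▸ hs

/-- The composition of simplicial maps. -/
def SimplicialMap.comp {W Y : Type*} {L : AbstractSimplicialComplex W}
    {M : AbstractSimplicialComplex Y} (g : SimplicialMap L M) (f : SimplicialMap K L) :
    SimplicialMap K M where
  toFun := g.toFun ∘ f.toFun
  map_faces s hs t ht := by
    classical
    exact g.map_faces _ (f.map_mem hs) t (by rw [ht, Set.image_comp, Finset.coe_image])

theorem SimplicialMap.realization_id : (SimplicialMap.id K).realization = ContinuousMap.id _ := by
  ext x
  exact Subtype.ext Finsupp.mapDomain_id

theorem SimplicialMap.realization_comp {W Y : Type*} {L : AbstractSimplicialComplex W}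
    {M : AbstractSimplicialComplex Y} (g : SimplicialMap L M) (f : SimplicialMap K L) :
    (g.comp f).realization = g.realization.comp f.realization := by
  ext x
  exact Subtype.ext (show Finsupp.mapDomain (g.toFun ∘ f.toFun) x.1 =
    Finsupp.mapDomain g.toFun (Finsupp.mapDomain f.toFun x.1) from Finsupp.mapDomain_comp)

end Realization

/-! ## Criteria for expansions -/

namespace InverseSystem

variable {C : Type u} [Category.{v} C]

theorem const_agree_iff {c d : C} {i j : (const.{w} c).Index} (f g : c ⟶ d) :
    (const.{w} c).Agree (i := i) (j := j) f g ↔ f = g := by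
  constructor
  · rintro ⟨k, hi, hj, e⟩
    exact (Category.id_comp f).symm.trans (e.trans (Category.id_comp g))
  · rintro rfl
    exact ⟨i, le_rfl, le_rfl, rfl⟩

/-- The morphism from an object to an inverse system given by a cone. -/
def coneHom {c : C} {S : InverseSystem.{w} C} (p : ∀ i, c ⟶ S.term i)
    (hp : ∀ i j (h : i ≤ j), p j ≫ S.bond h = p i) : PreHom (const.{w} c) S where
  index _ := PUnit.unit
  hom i := p i
  compat {i j} h := (const_agree_iff (p i) (p j ≫ S.bond h)).2 (hp i j h).symm

/-- Reduces the universal property in the pro-category to single targets `T.term t`. The condition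
`huniq` does double duty: it makes the chosen factorizations compatible with the bonding morphisms
of `T`, and it makes the resulting morphism unique. -/
theorem existsUnique_factor {c : C} {S : InverseSystem.{w} C} (p : ∀ i, c ⟶ S.term i)
    (hp : ∀ i j (h : i ≤ j), p j ≫ S.bond h = p i) (T : InverseSystem.{w} C)
    (hfac : ∀ t (h : c ⟶ T.term t), ∃ i, ∃ g : S.term i ⟶ T.term t, p i ≫ g = h)
    (huniq : ∀ t i (g g' : S.term i ⟶ T.term t), p i ≫ g = p i ≫ g' →
      ∃ j, ∃ h : i ≤ j, S.bond h ≫ g = S.bond h ≫ g')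
    (h : const.{w} c ⟶ T) : ∃! f : S ⟶ T, (⟦coneHom p hp⟧ : const.{w} c ⟶ S) ≫ f = h := by
  have hagree : ∀ t i j (g : S.term i ⟶ T.term t) (g' : S.term j ⟶ T.term t),
      p i ≫ g = p j ≫ g' → S.Agree g g' := by
    intro t i j g g' e
    -- Factorizations through different terms are first pulled back to a common one, where `huniq`
    -- applies.
    obtain ⟨k, hi, hj⟩ := exists_ge_ge i j
    obtain ⟨l, hl, e'⟩ := huniq t k (S.bond hi ≫ g) (S.bond hj ≫ g') (by
      rw [← Category.assoc, ← Category.assoc, hp, hp, e])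
    refine ⟨l, hi.trans hl, hj.trans hl, ?_⟩
    rw [← S.bond_comp hi hl, ← S.bond_comp hj hl, Category.assoc, Category.assoc, e']
  obtain ⟨h⟩ := h
  choose i g hg using fun t => hfac t (h.hom t)
  let f : PreHom S T :=
    { index := i
      hom := g
      compat := fun {t t'} ht => hagree t _ _ _ _ (by
        have h1 := (const_agree_iff (h.hom t) (h.hom t' ≫ T.bond ht)).1 (h.compat ht)
        rw [← Category.assoc, hg, hg]
        exact h1) }
  refine ⟨⟦f⟧, Quotient.sound fun t => ?_, ?_⟩
  · exact (const_agree_iff (p (i t) ≫ g t) (h.hom t)).2 (hg t)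
  · rintro ⟨f'⟩ hf'
    refine Quotient.sound fun t => hagree t _ _ _ _ ?_
    have h1 := Quotient.exact hf' t
    exact ((const_agree_iff (p (f'.index t) ≫ f'.hom t) (h.hom t)).1 h1).trans (hg t).symm

/-- The bonding morphisms of an inverse sequence. -/
def seqBond (K : ℕ → C) (b : ∀ n, K (n + 1) ⟶ K n) {n m : ℕ} (h : n ≤ m) : K m ⟶ K n :=
  (Functor.ofOpSequence b).map (homOfLE h).op

theorem seqBond_refl (K : ℕ → C) (b : ∀ n, K (n + 1) ⟶ K n) (n : ℕ) :
    seqBond K b (le_refl n) = 𝟙 _ :=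
  (Functor.ofOpSequence b).map_id _

theorem seqBond_succ (K : ℕ → C) (b : ∀ n, K (n + 1) ⟶ K n) {n m : ℕ} (h : n ≤ m) :
    seqBond K b (h.trans m.le_succ) = b m ≫ seqBond K b h :=
  ((Functor.ofOpSequence b).map_comp (homOfLE m.le_succ).op (homOfLE h).op).trans
    (congrArg (· ≫ seqBond K b h) (Functor.ofOpSequence_map_homOfLE_succ b m))

/-- The morphism `q` is fixed before `T`, as the definition of an expansion requires, and the cone
condition is only asked of consecutive terms. -/
theorem exists_factor_ofSequence {c : C} {K : ℕ → C} {b : ∀ n, K (n + 1) ⟶ K n}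
    (p : ∀ n, c ⟶ K n) (hp : ∀ n, p (n + 1) ≫ b n = p n) :
    ∃ q : const.{w} c ⟶ ofSequence.{w} K b, ∀ T : InverseSystem.{w} C,
      (∀ t (h : c ⟶ T.term t), ∃ n, ∃ g : K n ⟶ T.term t, p n ≫ g = h) →
      (∀ t n (g g' : K n ⟶ T.term t), p n ≫ g = p n ≫ g' →
        ∃ m, ∃ h : n ≤ m, seqBond K b h ≫ g = seqBond K b h ≫ g') →
      ∀ h : const.{w} c ⟶ T, ∃! f : ofSequence.{w} K b ⟶ T, q ≫ f = h := by
  have hcone : ∀ {n m : ℕ} (h : n ≤ m), p m ≫ seqBond K b h = p n := by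
    intro n m h
    induction m, h using Nat.le_induction with
    | base => rw [seqBond_refl, Category.comp_id]
    | succ m h ih => rw [seqBond_succ K b h, ← Category.assoc, hp, ih]
  refine ⟨⟦coneHom (S := ofSequence.{w} K b) (fun i => p i.down) fun i j h => hcone h⟧,
    fun T hfac huniq => existsUnique_factor (S := ofSequence.{w} K b) _ _ T ?_ ?_⟩
  · intro t h
    obtain ⟨n, g, hg⟩ := hfac t h
    exact ⟨⟨n⟩, g, hg⟩
  · rintro t ⟨n⟩ g g' hg
    obtain ⟨m, h, e⟩ := huniq t n g g' hg
    exact ⟨⟨m⟩, h, e⟩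

/-- A levelwise morphism of inverse sequences. -/
def sequenceHom {K L : ℕ → C} {b : ∀ n, K (n + 1) ⟶ K n} {d : ∀ n, L (n + 1) ⟶ L n}
    (e : ∀ n, K n ⟶ L n) (he : ∀ n, b n ≫ e n = e (n + 1) ≫ d n) :
    PreHom (ofSequence.{w} K b) (ofSequence.{w} L d) where
  index i := i
  hom i := e i.down
  compat {i j} h := by
    refine ⟨j, h, le_rfl, ?_⟩
    let η : Functor.ofOpSequence b ⟶ Functor.ofOpSequence d := NatTrans.ofOpSequence e (by
      intro n
      rw [Functor.ofOpSequence_map_homOfLE_succ, Functor.ofOpSequence_map_homOfLE_succ]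
      exact he n)
    refine (η.naturality (homOfLE (show i.down ≤ j.down from h)).op).trans ?_
    refine (Category.id_comp (e j.down ≫ _)).symm.trans (congrArg (· ≫ _) ?_)
    exact ((ofSequence.{w} K b).bond_refl j).symm

/-- Levelwise isomorphic inverse sequences are isomorphic. -/
def sequenceIso {K L : ℕ → C} {b : ∀ n, K (n + 1) ⟶ K n} {d : ∀ n, L (n + 1) ⟶ L n}
    (e : ∀ n, K n ≅ L n) (he : ∀ n, b n ≫ (e n).hom = (e (n + 1)).hom ≫ d n) :
    ofSequence.{w} K b ≅ ofSequence.{w} L d where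
  hom := ⟦sequenceHom (fun n => (e n).hom) he⟧
  inv := ⟦sequenceHom (fun n => (e n).inv) fun n => by
    rw [Iso.comp_inv_eq, Category.assoc, he, Iso.inv_hom_id_assoc]⟧
  hom_inv_id := Quotient.sound fun i => by
    exact ((e i.down).hom_inv_id ▸ Agree.refl _ :
      (ofSequence.{w} K b).Agree (i := i) (j := i) ((e i.down).hom ≫ (e i.down).inv) (𝟙 _))
  inv_hom_id := Quotient.sound fun i => by
    exact ((e i.down).inv_hom_id ▸ Agree.refl _ :
      (ofSequence.{w} L d).Agree (i := i) (j := i) ((e i.down).inv ≫ (e i.down).hom) (𝟙 _))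

end InverseSystem

theorem IsHPolExpansion.of_iso {X : Type u} [TopologicalSpace X] {S S' : InverseSystem.{w} HTop.{u}}
    (h : IsHPolExpansion X S) (e : S ≅ S') (hS' : ∀ i, IsHPol (S'.term i)) :
    IsHPolExpansion X S' := by
  obtain ⟨p, hp⟩ := h.2
  refine ⟨hS', p ≫ e.hom, fun T hT h => ?_⟩
  obtain ⟨f, hf, huniq⟩ := hp T hT h
  refine ⟨e.inv ≫ f, by simpa using hf, fun f' hf' => ?_⟩
  rw [← huniq (e.hom ≫ f') (by simpa using hf'), Iso.inv_hom_id_assoc]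

namespace HTop

theorem ofMap_eq_iff {X Y : Type u} [TopologicalSpace X] [TopologicalSpace Y] {f g : C(X, Y)} :
    ofMap f = ofMap g ↔ f.Homotopic g :=
  CategoryTheory.Quotient.functor_map_eq_iff homotopyRel (TopCat.ofHom f) (TopCat.ofHom g)

theorem ofMap_comp {X Y Z : Type u} [TopologicalSpace X] [TopologicalSpace Y] [TopologicalSpace Z]
    (g : C(Y, Z)) (f : C(X, Y)) : ofMap (g.comp f) = ofMap f ≫ ofMap g :=
  (CategoryTheory.Quotient.functor homotopyRel).map_comp (TopCat.ofHom f) (TopCat.ofHom g)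

theorem ofMap_id (X : Type u) [TopologicalSpace X] : ofMap (ContinuousMap.id X) = 𝟙 (of X) :=
  (CategoryTheory.Quotient.functor homotopyRel).map_id (TopCat.of X)

theorem exists_ofMap {X Y : Type u} [TopologicalSpace X] [TopologicalSpace Y]
    (h : of X ⟶ of Y) : ∃ f : C(X, Y), ofMap f = h := by
  obtain ⟨f, hf⟩ := (CategoryTheory.Quotient.functor homotopyRel).map_surjective h
  exact ⟨f.hom, hf⟩

/-- Mutually inverse homotopy equivalences as an isomorphism of `HTop`. -/
def isoOfHomotopic {X Y : Type u} [TopologicalSpace X] [TopologicalSpace Y] (f : C(X, Y))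
    (g : C(Y, X)) (h : (g.comp f).Homotopic (ContinuousMap.id X))
    (h' : (f.comp g).Homotopic (ContinuousMap.id Y)) : of X ≅ of Y where
  hom := ofMap f
  inv := ofMap g
  hom_inv_id := by rw [← ofMap_comp, ofMap_eq_iff.2 h, ofMap_id]
  inv_hom_id := by rw [← ofMap_comp, ofMap_eq_iff.2 h', ofMap_id]

end HTop

theorem isHPol_realization {V : Type u} (K : AbstractSimplicialComplex V) :
    IsHPol (HTop.of (Realization K)) := ⟨V, K, ⟨Iso.refl _⟩⟩

/-! ### Inverse sequences of polyhedra -/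

section Sequence

variable {V : ℕ → Type u} {K : ∀ n, AbstractSimplicialComplex (V n)}
  {f : ∀ n, SimplicialMap (K (n + 1)) (K n)}

variable (K f) in
/-- The bonding morphisms of a sequence of polyhedra. -/
def polyhedralBond {n m : ℕ} (h : n ≤ m) :
    HTop.of (Realization (K m)) ⟶ HTop.of (Realization (K n)) :=
  InverseSystem.seqBond (fun n => HTop.of (Realization (K n)))
    (fun n => HTop.ofMap (f n).realization) h

/-- The bonding maps of a sequence of polyhedra are realizations of simplicial maps, which inherit
the properties stable under composition with the bonding simplicial maps. -/
theorem exists_bond_eq_ofMap (P : ∀ m n, (V m → V n) → Prop) (hid : ∀ n, P n n id)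
    (hcomp : ∀ m n (g : V m → V n), P m n g → P (m + 1) n (g ∘ (f m).toFun))
    {n m : ℕ} (h : n ≤ m) : ∃ k : SimplicialMap (K m) (K n), P m n k.toFun ∧
      polyhedralBond K f h = HTop.ofMap k.realization := by
  induction m, h using Nat.le_induction with
  | base =>
    refine ⟨SimplicialMap.id _, hid n, ?_⟩
    rw [SimplicialMap.realization_id, HTop.ofMap_id]
    exact InverseSystem.seqBond_refl _ _ _
  | succ m h ih =>
    obtain ⟨k, hk, e⟩ := ih
    refine ⟨k.comp (f m), hcomp _ _ _ hk, ?_⟩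
    rw [SimplicialMap.realization_comp, HTop.ofMap_comp, ← e]
    exact InverseSystem.seqBond_succ _ _ h

/-- Criterion for a sequence of polyhedra to be an expansion. -/
theorem isHPolExpansion_polyhedralSequence {X : Type u} [TopologicalSpace X]
    (p : ∀ n, C(X, Realization (K n)))
    (hp : ∀ n, ((f n).realization.comp (p (n + 1))).Homotopic (p n))
    (hfac : ∀ (W : Type u) (L : AbstractSimplicialComplex W) (h : C(X, Realization L)),
      ∃ n, ∃ g : C(Realization (K n), Realization L), (g.comp (p n)).Homotopic h)
    (huniq : ∀ (W : Type u) (L : AbstractSimplicialComplex W) (n : ℕ)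
      (g g' : C(Realization (K n), Realization L)), (g.comp (p n)).Homotopic (g'.comp (p n)) →
      ∃ m, ∃ h : n ≤ m, ∃ k : SimplicialMap (K m) (K n),
        polyhedralBond K f h = HTop.ofMap k.realization ∧
        (g.comp k.realization).Homotopic (g'.comp k.realization)) :
    IsHPolExpansion.{w} X (polyhedralSequence.{w} K f) := by
  obtain ⟨q, hq⟩ := InverseSystem.exists_factor_ofSequence.{w}
    (K := fun n => HTop.of (Realization (K n))) (b := fun n => HTop.ofMap (f n).realization)
    (fun n => HTop.ofMap (p n)) fun n => by
      rw [← HTop.ofMap_comp]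
      exact HTop.ofMap_eq_iff.2 (hp n)
  refine ⟨fun i => isHPol_realization _, q, fun T hT => hq T ?_ ?_⟩
  · intro t h
    -- An object of `HPol` is only isomorphic to a realization in `HTop`; morphisms are carried
    -- along `e` and represented by continuous maps.
    obtain ⟨W, L, ⟨e⟩⟩ := hT t
    obtain ⟨h', hh'⟩ := HTop.exists_ofMap (h ≫ e.hom)
    obtain ⟨n, g, hg⟩ := hfac W L h'
    refine ⟨n, HTop.ofMap g ≫ e.inv, ?_⟩
    rw [← Category.assoc, ← HTop.ofMap_comp, HTop.ofMap_eq_iff.2 hg, hh', Category.assoc,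
      e.hom_inv_id, Category.comp_id]
  · intro t n g g' hgg
    obtain ⟨W, L, ⟨e⟩⟩ := hT t
    obtain ⟨a, ha⟩ := HTop.exists_ofMap (g ≫ e.hom)
    obtain ⟨a', ha'⟩ := HTop.exists_ofMap (g' ≫ e.hom)
    obtain ⟨m, hm, k, hk, hom⟩ := huniq W L n a a' (by
      rw [← HTop.ofMap_eq_iff, HTop.ofMap_comp, HTop.ofMap_comp, ha, ha', ← Category.assoc,
        ← Category.assoc, hgg])
    refine ⟨m, hm, ?_⟩
    rw [← HTop.ofMap_eq_iff, HTop.ofMap_comp, HTop.ofMap_comp, ha, ha', ← hk,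
      ← Category.assoc, ← Category.assoc] at hom
    exact (cancel_mono e.hom).1 hom

/-- Transfer of expansions along levelwise homotopy equivalences. -/
theorem IsHPolExpansion.of_levelwise {X : Type u} [TopologicalSpace X] {V' : ℕ → Type u}
    {K' : ∀ n, AbstractSimplicialComplex (V' n)} {f' : ∀ n, SimplicialMap (K' (n + 1)) (K' n)}
    (hK : IsHPolExpansion.{w} X (polyhedralSequence.{w} K f))
    (e : ∀ n, HTop.of (Realization (K n)) ≅ HTop.of (Realization (K' n)))
    (he : ∀ n, HTop.ofMap (f n).realization ≫ (e n).hom =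
      (e (n + 1)).hom ≫ HTop.ofMap (f' n).realization) :
    IsHPolExpansion.{w} X (polyhedralSequence.{w} K' f') :=
  hK.of_iso (InverseSystem.sequenceIso e he) fun _ => isHPol_realization _

end Sequence

/-! ## Approximation of maps to realizations -/

section Approximation

variable {V : Type u} {W : Type v} {K : AbstractSimplicialComplex V}
  {L : AbstractSimplicialComplex W}

/-- Since `|L|` need not be metrizable, uniform continuity is expressed through the finitely many
coordinates that do not vanish identically on the compact space `Z`. -/
theorem Realization.exists_continuous_coord {Z : Type*} [TopologicalSpace Z] [CompactSpace Z]
    (g : C(Z, Realization L)) : ∃ S : Finset W, (∀ z, (g z).1.support ⊆ S) ∧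
      ∃ F : Z → S → ℝ, Continuous F ∧ ∀ x y δ, 0 < δ → dist (F x) (F y) < δ →
        ∀ w, |(g x).1 w - (g y).1 w| < δ := by
  obtain ⟨S, hS⟩ := exists_support_subset g
  refine ⟨S, hS, fun z w => (g z).1 w,
    continuous_pi fun w => (continuous_coord w.1).comp g.continuous, fun x y δ hδ h w => ?_⟩
  by_cases hw : w ∈ S
  · exact (dist_pi_lt_iff hδ).1 h ⟨w, hw⟩
  · have h0 : ∀ z, (g z).1 w = 0 := fun z => by
      by_contra hne
      exact hw (hS z (Finsupp.mem_support_iff.2 hne))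
    rw [h0, h0, sub_zero, abs_zero]
    exact hδ

theorem Realization.exists_modulus {Z : Type*} [PseudoMetricSpace Z] [CompactSpace Z]
    (g : C(Z, Realization L)) {δ : ℝ} (hδ : 0 < δ) :
    ∃ r > 0, ∀ x y, dist x y < r → ∀ w, |(g x).1 w - (g y).1 w| < δ := by
  obtain ⟨S, -, F, hF, hFg⟩ := exists_continuous_coord g
  obtain ⟨r, hr, H⟩ := Metric.uniformContinuous_iff.1
    (CompactSpace.uniformContinuous_of_continuous hF) δ hδ
  exact ⟨r, hr, fun x y hxy => hFg x y δ hδ (H hxy)⟩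

theorem Realization.exists_coord_modulus [Finite V] (g : C(Realization K, Realization L)) {δ : ℝ}
    (hδ : 0 < δ) : ∃ η > 0, ∀ x y : Realization K, (∀ v, |x.1 v - y.1 v| < η) →
      ∀ w, |(g x).1 w - (g y).1 w| < δ := by
  have := compactSpace_of_finite K
  obtain ⟨S, -, F, hF, hFg⟩ := exists_continuous_coord g
  obtain ⟨η, hη, H⟩ := exists_uniform_modulus hF hδ
  exact ⟨η, hη, fun x y hxy => hFg x y δ hδ (H x y hxy)⟩

/-- The coordinates sum to 1, so they cannot all be at most `1 / (|S| + 1)`; the extra 1 makes the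
inequality strict. -/
theorem Realization.exists_lt_coord {S : Finset W} (x : Realization L) (h : x.1.support ⊆ S) :
    ∃ w ∈ S, 1 / ((S.card : ℝ) + 1) < x.1 w := by
  by_contra! hcon
  have h1 := Finset.sum_le_sum hcon
  rw [x.sum_eq_one h, Finset.sum_const, nsmul_eq_mul, mul_one_div,
    le_div_iff₀ (by positivity)] at h1
  linarith

/-- The affine extension of a map of the vertices of a finite complex to a realization. -/
theorem exists_affine_extension [Fintype V] [Finite W] (u : V → Realization L)
    (hu : ∀ s ∈ K.faces, ∃ T ∈ L.faces, ∀ a ∈ s, (u a).1.support ⊆ T) :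
    ∃ q : C(Realization K, Realization L), ∀ y w, (q y).1 w = ∑ a, y.1 a * (u a).1 w := by
  classical
  have : Fintype W := Fintype.ofFinite W
  let ω : W → Realization K → ℝ := fun w y => ∑ a, y.1 a * (u a).1 w
  have h0 : ∀ w y, 0 ≤ ω w y := fun w y =>
    Finset.sum_nonneg fun a _ => mul_nonneg (y.nonneg a) ((u a).nonneg w)
  have hsum : ∀ y, ∑ w, ω w y = 1 := fun y => by
    simp only [ω]
    rw [Finset.sum_comm]
    simp only [← Finset.mul_sum, Realization.sum_eq_one _ (Finset.subset_univ _), mul_one]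
  obtain ⟨q, hq⟩ := Realization.exists_continuousMap_of_weights (K := L) Finset.univ ω
    (fun w _ => continuous_finsetSum _ fun a _ => (Realization.continuous_coord a).mul
      continuous_const) (fun w _ => h0 w)
    (fun y => by
      by_contra! hcon
      have := Finset.sum_nonpos hcon
      rw [hsum] at this
      linarith)
    (fun y => by
      obtain ⟨T, hT, hTu⟩ := hu _ y.support_mem
      refine ⟨T, hT, fun w _ hw => ?_⟩
      obtain ⟨a, -, ha⟩ := Finset.exists_ne_zero_of_sum_ne_zero hw.ne'
      exact hTu a (Finsupp.mem_support_iff.2 (left_ne_zero_of_mul ha))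
        (Finsupp.mem_support_iff.2 (right_ne_zero_of_mul ha)))
  refine ⟨q, fun y w => ?_⟩
  rw [(hq y).1 w (Finset.mem_univ w), hsum, div_one]

/-- A homotopy on a compact metric space can be extended, after truncation of the small barycentric
coordinates, from the vertices of any finite complex with small simplices. -/
theorem exists_truncated_extension {X : Type*} [MetricSpace X] [CompactSpace X]
    (H : C(unitInterval × X, Realization L)) : ∃ δ > 0, ∃ r > 0,
      (∀ t x x' w, dist x x' < r → δ < (H (t, x')).1 w → 0 < (H (t, x)).1 w) ∧
      ∀ {V : Type u} [Finite V] (K : AbstractSimplicialComplex V) (ρ : V → X),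
        (∀ s ∈ K.faces, ∃ x, ∀ a ∈ s, dist x (ρ a) < r) →
        ∃ G : C(unitInterval × Realization K, Realization L), ∀ t y w, 0 < (G (t, y)).1 w →
          ∃ a, 0 < y.1 a ∧ δ < (H (t, ρ a)).1 w := by
  classical
  obtain ⟨S, hS⟩ := Realization.exists_support_subset H
  -- By `exists_lt_coord` every value of `H` has a coordinate above this threshold, so truncation
  -- never removes all of them.
  let δ : ℝ := 1 / ((S.card : ℝ) + 1)
  have hδ : 0 < δ := by positivity
  obtain ⟨r, hr, hrH⟩ := Realization.exists_modulus H hδ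
  have hclose : ∀ t x x' w, dist x x' < r → δ < (H (t, x')).1 w → 0 < (H (t, x)).1 w := by
    intro t x x' w hx hw
    have h1 := hrH (t, x) (t, x') (by simpa [Prod.dist_eq, hr] using hx) w
    rw [abs_lt] at h1
    linarith
  refine ⟨δ, hδ, r, hr, hclose, fun {V} _ K ρ hρ => ?_⟩
  have : Fintype V := Fintype.ofFinite V
  -- Average, over the vertices `a`, of the excess over `δ` of the coordinates of `H (t, ρ a)`. If
  -- the positions lie within `r` of `x`, a positive weight at `w` forces a positive coordinate of
  -- `H (t, x)`, so the support stays in one simplex.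
  let ω : W → unitInterval × Realization K → ℝ := fun w p =>
    ∑ a, p.2.1 a * max 0 ((H (p.1, ρ a)).1 w - δ)
  have h0 : ∀ w p, 0 ≤ ω w p := fun w p =>
    Finset.sum_nonneg fun a _ => mul_nonneg (p.2.nonneg a) (le_max_left _ _)
  have hω : ∀ w p, 0 < ω w p → ∃ a, 0 < p.2.1 a ∧ δ < (H (p.1, ρ a)).1 w := by
    intro w p hw
    obtain ⟨a, -, ha⟩ := Finset.exists_ne_zero_of_sum_ne_zero hw.ne'
    refine ⟨a, lt_of_le_of_ne (p.2.nonneg a) (left_ne_zero_of_mul ha).symm, ?_⟩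
    by_contra hle
    exact right_ne_zero_of_mul ha (max_eq_left (by linarith))
  obtain ⟨G, hG⟩ := Realization.exists_continuousMap_of_weights (K := L) S ω
    (fun w _ => continuous_finsetSum _ fun a _ => by
      have h1 : Continuous fun p : unitInterval × Realization K => p.2.1 a :=
        (Realization.continuous_coord a).comp continuous_snd
      have h2 : Continuous fun p : unitInterval × Realization K => (H (p.1, ρ a)).1 w :=
        (Realization.continuous_coord w).comp
          (H.continuous.comp (continuous_fst.prodMk continuous_const))
      fun_prop) (fun w _ => h0 w)
    (fun p => by
      obtain ⟨a, ha⟩ := p.2.exists_pos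
      obtain ⟨w, hw, hwa⟩ := (H (p.1, ρ a)).exists_lt_coord (hS _)
      refine ⟨w, hw, Finset.sum_pos' (fun b _ => mul_nonneg (p.2.nonneg b) (le_max_left _ _))
        ⟨a, Finset.mem_univ a, mul_pos ha (lt_max_of_lt_right (sub_pos.2 hwa))⟩⟩)
    (fun p => by
      obtain ⟨x, hx⟩ := hρ _ p.2.support_mem
      refine ⟨_, (H (p.1, x)).support_mem, fun w _ hw => ?_⟩
      obtain ⟨a, ha, hwa⟩ := hω w p hw
      exact (Realization.mem_support_iff _ _).2
        (hclose _ _ _ _ (hx a ((Realization.mem_support_iff _ _).2 ha)) hwa))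
  exact ⟨G, fun t y w hw => hω w _ (Realization.pos_of_weights (fun w _ => h0 w _) (hG _) hw).2⟩

/-- The carrier of `g' z` is a common simplex. -/
theorem Realization.homotopic_of_pos_imp {Z : Type*} [TopologicalSpace Z] [CompactSpace Z]
    (g g' : C(Z, Realization L)) (h : ∀ z w, 0 < (g z).1 w → 0 < (g' z).1 w) : g.Homotopic g' :=
  homotopic_of_common_face g g' fun z => ⟨_, (g' z).support_mem, fun w =>
    ⟨fun hw => (mem_support_iff _ _).2 (h z w hw), fun hw => (mem_support_iff _ _).2 hw⟩⟩

end Approximation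

/-! ## Sequences of complexes approximating a compact metric space -/

/-- A sequence of complexes together with positions `ρ n v` of the vertices in the metric space `X`
and relations `near n x v` of nearness between points and vertices: points near to a vertex are at
small distance of its position, the vertices near to a point span a simplex, nearness is
preserved by the simplicial maps, and the image of a simplex is near to some point. -/
structure Approximation (X : Type u) [MetricSpace X] {V : ℕ → Type u}
    (K : ∀ n, AbstractSimplicialComplex (V n)) (f : ∀ n, SimplicialMap (K (n + 1)) (K n)) where
  ρ : ∀ n, V n → X
  near : ∀ n, X → V n → Prop
  mesh : ℕ → ℝ
  tendsto_mesh : Filter.Tendsto mesh Filter.atTop (𝓝 0)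
  isOpen_near : ∀ n v, IsOpen {x | near n x v}
  exists_near : ∀ n x, ∃ v, near n x v
  mem_faces : ∀ n x (s : Finset (V n)), s.Nonempty → (∀ v ∈ s, near n x v) → s ∈ (K n).faces
  near_map : ∀ n x v, near (n + 1) x v → near n x ((f n).toFun v)
  exists_center : ∀ n, ∀ s ∈ (K (n + 1)).faces, ∃ x, ∀ a ∈ s,
    near n x ((f n).toFun a) ∧ dist x (ρ (n + 1) a) < mesh (n + 1)
  dist_lt : ∀ n x v, near n x v → dist x (ρ n v) < mesh n

namespace Approximation

variable {X : Type u} [MetricSpace X] {V : ℕ → Type u}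
  {K : ∀ n, AbstractSimplicialComplex (V n)} {f : ∀ n, SimplicialMap (K (n + 1)) (K n)}
  (A : Approximation X K f)

theorem exists_mesh_lt {r : ℝ} (hr : 0 < r) (n : ℕ) : ∃ m, n ≤ m ∧ A.mesh (m + 1) < r := by
  have h := ((A.tendsto_mesh.comp (Filter.tendsto_add_atTop_nat 1)).eventually
    (gt_mem_nhds hr)).and (Filter.eventually_ge_atTop n)
  obtain ⟨m, hm, hn⟩ := h.exists
  exact ⟨m, hn, hm⟩

variable [∀ n, Finite (V n)]

theorem exists_face (n : ℕ) (x : X) : ∃ T ∈ (K n).faces, ∀ v, A.near n x v → v ∈ T := by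
  classical
  have : Fintype (V n) := Fintype.ofFinite _
  obtain ⟨v, hv⟩ := A.exists_near n x
  exact ⟨Finset.univ.filter (A.near n x), A.mem_faces n x _ ⟨v, by simpa using hv⟩ (by simp),
    by simp⟩

/-- A partition of unity subordinate to the nearness sets gives the map. Keeping the closures inside
these open sets leaves the margin used in `exists_near_of_dist_lt`. -/
theorem exists_map (n : ℕ) : ∃ p : C(X, Realization (K n)),
    ∀ v, closure {x | 0 < (p x).1 v} ⊆ {x | A.near n x v} := by
  classical
  have : Fintype (V n) := Fintype.ofFinite _
  obtain ⟨φ, hφ⟩ := PartitionOfUnity.exists_isSubordinate (X := X) isClosed_univ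
    (fun v : V n => {x | A.near n x v}) (A.isOpen_near n) fun x _ => by
      obtain ⟨v, hv⟩ := A.exists_near n x
      exact Set.mem_iUnion.2 ⟨v, hv⟩
  have hsum : ∀ x, ∑ v, φ v x = 1 := fun x => by
    rw [← finsum_eq_sum_of_fintype]
    exact φ.sum_eq_one (Set.mem_univ x)
  obtain ⟨p, hp⟩ := Realization.exists_continuousMap_of_weights (K := K n) Finset.univ
    (fun v x => φ v x) (fun v _ => (φ v).continuous) (fun v _ x => φ.nonneg v x)
    (fun x => by
      by_contra! hcon
      have := Finset.sum_nonpos hcon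
      rw [hsum] at this
      linarith)
    (fun x => by
      obtain ⟨T, hT, hTx⟩ := A.exists_face n x
      exact ⟨T, hT, fun v _ hv => hTx v (hφ v (subset_tsupport _ hv.ne'))⟩)
  refine ⟨p, fun v => (closure_mono fun x hx => ?_).trans (hφ v)⟩
  exact (Realization.pos_of_weights (fun v _ => φ.nonneg v x) (hp x) hx).2.ne'

variable [CompactSpace X]

/-- A compact set inside an open one has a thickening inside it, and there are finitely many
vertices. -/
theorem exists_near_of_dist_lt {n : ℕ} {p : C(X, Realization (K n))}
    (hp : ∀ v, closure {x | 0 < (p x).1 v} ⊆ {x | A.near n x v}) :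
    ∃ r > 0, ∀ x x' v, dist x x' < r → 0 < (p x').1 v → A.near n x v := by
  have h : ∀ v, ∃ r > 0, Metric.thickening r (closure {x | 0 < (p x).1 v}) ⊆
      {x | A.near n x v} := fun v =>
    isClosed_closure.isCompact.exists_thickening_subset_open (A.isOpen_near n v) (hp v)
  choose r hr hrs using h
  -- A positive number below all the `r v`, found in the right neighbourhoods of 0 so that an empty
  -- vertex set needs no separate treatment.
  obtain ⟨s, hsr, hs⟩ := ((Filter.eventually_all.2 fun v =>
    mem_nhdsWithin_of_mem_nhds (gt_mem_nhds (hr v))).and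
      (self_mem_nhdsWithin (s := Set.Ioi (0 : ℝ)))).exists
  refine ⟨s, hs, fun x x' v hx hv => hrs v ?_⟩
  exact Metric.mem_thickening_iff.2 ⟨x', subset_closure hv, hx.trans (hsr v)⟩

theorem isHPolExpansion (A : Approximation X K f) :
    IsHPolExpansion.{w} X (polyhedralSequence.{w} K f) := by
  classical
  choose p hp using A.exists_map
  have hnear : ∀ n x v, 0 < (p n x).1 v → A.near n x v := fun n x v h =>
    hp n v (subset_closure h)
  refine isHPolExpansion_polyhedralSequence p ?_ ?_ ?_
  · intro n
    refine Realization.homotopic_of_common_face _ _ fun x => ?_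
    obtain ⟨T, hT, hTx⟩ := A.exists_face n x
    refine ⟨T, hT, fun v => ⟨fun h => hTx v ?_, fun h => hTx v (hnear n x v h)⟩⟩
    obtain ⟨a, ha, rfl⟩ := (f n).realization_pos h
    exact A.near_map n x a (hnear _ _ _ ha)
  · intro W L h
    -- Existence: the extension is applied to the constant homotopy at `h`, and its slice at time 0
    -- is the factorization.
    obtain ⟨δ, hδ, r, hr, hclose, hext⟩ :=
      exists_truncated_extension.{u} (h.comp (ContinuousMap.snd : C(unitInterval × X, X)))
    obtain ⟨m, -, hm⟩ := A.exists_mesh_lt hr 0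
    obtain ⟨G, hG⟩ := hext (K (m + 1)) (A.ρ (m + 1)) fun s hs => by
      obtain ⟨x, hx⟩ := A.exists_center m s hs
      exact ⟨x, fun a ha => (hx a ha).2.trans hm⟩
    refine ⟨m + 1, G.curry 0, Realization.homotopic_of_pos_imp _ _ fun x w hw => ?_⟩
    obtain ⟨a, ha, hwa⟩ := hG 0 (p (m + 1) x) w hw
    exact hclose 0 x _ w ((A.dist_lt _ _ _ (hnear _ _ _ ha)).trans hm) hwa
  · rintro W L n g g' ⟨H⟩
    have : Fintype (V n) := Fintype.ofFinite _
    obtain ⟨δ, hδ, r, hr, hclose, hext⟩ := exists_truncated_extension.{u} H.toContinuousMap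
    -- Uniqueness. `η`, `η'` keep `g`, `g'` within `δ`; `r₁` keeps `p n` within half of their
    -- minimum, so that a strict bound survives averaging. The mesh is below `r₁ / 2` because two
    -- vertices of a simplex are compared through its centre.
    obtain ⟨η, hη, hηg⟩ := Realization.exists_coord_modulus g hδ
    obtain ⟨η', hη', hηg'⟩ := Realization.exists_coord_modulus g' hδ
    obtain ⟨r₁, hr₁, hr₁p⟩ := Realization.exists_modulus (p n)
      (half_pos (lt_min hη hη'))
    obtain ⟨r₂, hr₂, hr₂p⟩ := A.exists_near_of_dist_lt (hp n)
    obtain ⟨m, hnm, hm⟩ := A.exists_mesh_lt (lt_min hr (lt_min (half_pos hr₁) hr₂)) n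
    rw [lt_min_iff, lt_min_iff] at hm
    obtain ⟨hmr, hm₁, hm₂⟩ := hm
    have : Fintype (V (m + 1)) := Fintype.ofFinite _
    -- Simplices have a centre only after one bonding map, so the later term is `m + 1` and the
    -- simplicial map is `k.comp (f m)`.
    obtain ⟨k, hk, hbond⟩ := exists_bond_eq_ofMap (K := K) (f := f)
      (fun i j (k : V i → V j) => ∀ x v, A.near i x v → A.near j x (k v))
      (fun _ _ _ h => h) (fun i _ _ hk x v h => hk x _ (A.near_map i x v h)) hnm
    have hcenter : ∀ s ∈ (K (m + 1)).faces, ∃ x, ∀ a ∈ s,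
        A.near n x (k.toFun ((f m).toFun a)) ∧ dist x (A.ρ (m + 1) a) < A.mesh (m + 1) := by
      intro s hs
      obtain ⟨x, hx⟩ := A.exists_center m s hs
      exact ⟨x, fun a ha => ⟨hk _ _ (hx a ha).1, (hx a ha).2⟩⟩
    -- The affine extension `q` of `u` replaces the bonding map up to homotopy, and its values are
    -- comparable with those of `p n` at the vertex positions.
    let u : V (m + 1) → Realization (K n) := fun a => p n (A.ρ (m + 1) a)
    obtain ⟨q, hq⟩ := exists_affine_extension (K := K (m + 1)) u fun s hs => by
      obtain ⟨x, hx⟩ := hcenter s hs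
      obtain ⟨T, hT, hTx⟩ := A.exists_face n x
      exact ⟨T, hT, fun a ha v hv => hTx v (hr₂p x _ v ((hx a ha).2.trans hm₂)
        ((Realization.mem_support_iff _ _).1 hv))⟩
    have hcompact := Realization.compactSpace_of_finite (K (m + 1))
    -- Both images of `y` are supported on vertices near the centre of the carrier of `y`.
    have hkq : ((k.comp (f m)).realization).Homotopic q := by
      refine Realization.homotopic_of_common_face _ _ fun y => ?_
      obtain ⟨x, hx⟩ := hcenter _ y.support_mem
      obtain ⟨T, hT, hTx⟩ := A.exists_face n x
      refine ⟨T, hT, fun v => ⟨fun h => hTx v ?_, fun h => hTx v ?_⟩⟩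
      · obtain ⟨a, ha, rfl⟩ := (k.comp (f m)).realization_pos h
        exact (hx a ((y.mem_support_iff a).2 ha)).1
      · rw [hq] at h
        obtain ⟨a, -, ha⟩ := Finset.exists_ne_zero_of_sum_ne_zero h.ne'
        exact hr₂p x _ v ((hx a (Finsupp.mem_support_iff.2 (left_ne_zero_of_mul ha))).2.trans hm₂)
          (lt_of_le_of_ne (Realization.nonneg _ _) (right_ne_zero_of_mul ha).symm)
    -- The point `q y` is an average of points `u b` that are all close to `u a`.
    have hqu : ∀ y a v, 0 < y.1 a → |(u a).1 v - (q y).1 v| < min η η' := by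
      intro y a v ha
      obtain ⟨x, hx⟩ := hcenter _ y.support_mem
      have h1 : (u a).1 v - (q y).1 v = ∑ b, y.1 b * ((u a).1 v - (u b).1 v) := by
        simp only [mul_sub, Finset.sum_sub_distrib, ← Finset.sum_mul, hq,
          Realization.sum_eq_one y (Finset.subset_univ _), one_mul]
      have h2 : ∀ b, |y.1 b * ((u a).1 v - (u b).1 v)| ≤ y.1 b * (min η η' / 2) := by
        intro b
        rw [abs_mul, abs_of_nonneg (y.nonneg b)]
        rcases (y.nonneg b).eq_or_lt with hb | hb
        · rw [← hb, zero_mul, zero_mul]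
        · refine mul_le_mul_of_nonneg_left (hr₁p _ _ ?_ v).le hb.le
          have h3 := (hx a ((y.mem_support_iff a).2 ha)).2
          have h4 := (hx b ((y.mem_support_iff b).2 hb)).2
          have h5 := dist_triangle_left (A.ρ (m + 1) a) (A.ρ (m + 1) b) x
          linarith
      rw [h1]
      refine (Finset.abs_sum_le_sum_abs _ _).trans_lt ((Finset.sum_le_sum fun b _ => h2 b).trans_lt
        ?_)
      rw [← Finset.sum_mul, Realization.sum_eq_one y (Finset.subset_univ _), one_mul]
      exact half_lt_self (lt_min hη hη')
    obtain ⟨G, hG⟩ := hext (K (m + 1)) (A.ρ (m + 1)) fun s hs => by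
      obtain ⟨x, hx⟩ := hcenter s hs
      exact ⟨x, fun a ha => (hx a ha).2.trans hmr⟩
    -- A coordinate present in `G (t, y)` exceeds `δ` at some `g (u a)`; as `u a` is close to `q y`,
    -- it is still positive at `g (q y)`.
    have hend : ∀ (t : unitInterval) (g : C(Realization (K n), Realization L)),
        (∀ x, H (t, x) = g (p n x)) → (∀ x y : Realization (K n),
          (∀ v, |x.1 v - y.1 v| < min η η') → ∀ w, |(g x).1 w - (g y).1 w| < δ) →
        (G.curry t).Homotopic (g.comp q) := by
      intro t g hHg hg
      refine Realization.homotopic_of_pos_imp _ _ fun y w hw => ?_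
      obtain ⟨a, ha, hwa⟩ := hG t y w hw
      have h1 := hg _ _ (fun v => hqu y a v ha) w
      rw [abs_lt] at h1
      have h2 : δ < (g (u a)).1 w := by
        rw [← hHg]
        exact hwa
      change 0 < (g (q y)).1 w
      linarith
    have hg₀ := hend 0 g (fun x => H.map_zero_left x) fun x y h =>
      hηg x y fun v => (h v).trans_le (min_le_left _ _)
    have hg₁ := hend 1 g' (fun x => H.map_one_left x) fun x y h =>
      hηg' x y fun v => (h v).trans_le (min_le_right _ _)
    have hG₀₁ : (G.curry 0).Homotopic (G.curry 1) := ⟨⟨G, fun _ => rfl, fun _ => rfl⟩⟩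
    refine ⟨m + 1, hnm.trans m.le_succ, k.comp (f m), ?_, ?_⟩
    · rw [SimplicialMap.realization_comp, HTop.ofMap_comp, ← hbond]
      exact InverseSystem.seqBond_succ _ _ hnm
    · exact ((ContinuousMap.Homotopic.refl g).comp hkq).trans (hg₀.symm.trans (hG₀₁.trans
        (hg₁.trans ((ContinuousMap.Homotopic.refl g').comp hkq.symm))))

end Approximation

/-! ## McCord and Dowker complexes of a finite poset -/

section Poset

variable {P : Type u} [PartialOrder P]

theorem chain_mem_upperDowkerComplex {s : Finset P} (hs : s ∈ (mcCordComplex P).faces) :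
    s ∈ (upperDowkerComplex P).faces := by
  obtain ⟨hne, hc⟩ := hs
  obtain ⟨y, hy⟩ := Finset.exists_maximal hne
  refine ⟨hne, y, fun x hx => ?_⟩
  rcases hc.total hx hy.1 with h | h
  · exact h
  · exact hy.2 hx h

variable (P) in
/-- The inclusion of the complex of finite chains in the upper Dowker complex. -/
def mcCordInclusion : SimplicialMap (mcCordComplex P) (upperDowkerComplex P) where
  toFun := id
  map_faces s hs t ht := by
    rw [Set.image_id, Finset.coe_inj] at ht
    exact ht ▸ chain_mem_upperDowkerComplex hs

theorem mcCordInclusion_apply (y : Realization (mcCordComplex P)) (v : P) :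
    ((mcCordInclusion P).realization y).1 v = y.1 v :=
  DFunLike.congr_fun (Finsupp.mapDomain_id (v := y.1)) v

variable [Finite P]

/-- If the bounded subsets of a finite poset have suprema, the simplices of the upper Dowker
complex are continuously mapped to chains formed by suprema of their vertices. -/
theorem exists_map_upperDowker_mcCord
    (hP : ∀ s : Finset P, s.Nonempty → BddAbove (s : Set P) → ∃ a, IsLUB (s : Set P) a) :
    ∃ g : C(Realization (upperDowkerComplex P), Realization (mcCordComplex P)),
      ∀ y E, 0 < (g y).1 E →
        ∃ s : Finset P, s.Nonempty ∧ (∀ C ∈ s, 0 < y.1 C) ∧ IsLUB (s : Set P) E := by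
  classical
  have : Fintype P := Fintype.ofFinite P
  let Y := Realization (upperDowkerComplex P)
  -- `E` bounds the superlevel set `{C | t < y C}`, for `t ≥ 0`, exactly when `κ E y ≤ t`. The
  -- supremum of that set is thus the least `E` with `κ E y ≤ t`.
  let κ : P → Y → ℝ := fun E y =>
    ({C | ¬ C ≤ E} : Finset P).fold max 0 fun C => y.1 C
  let μ : Y → ℝ := fun y => (Finset.univ : Finset P).fold max 0 fun C => y.1 C
  have hfold : ∀ s : Finset P, Continuous fun y : Y => s.fold max 0 fun C => y.1 C := by
    intro s
    induction s using Finset.induction_on with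
    | empty => simpa using continuous_const
    | insert a s ha ih =>
      simp only [Finset.fold_insert ha]
      exact (Realization.continuous_coord a).max ih
  have hκ0 : ∀ E y, 0 ≤ κ E y := fun E y => (Finset.le_fold_max 0).2 (Or.inl le_rfl)
  have hle : ∀ E y C, κ E y < y.1 C → C ≤ E := by
    intro E y C h
    by_contra hC
    exact h.not_ge ((Finset.le_fold_max _).2 (Or.inr ⟨C, by simpa using hC, le_rfl⟩))
  have hμ : ∀ y C, y.1 C ≤ μ y := fun y C =>
    (Finset.le_fold_max _).2 (Or.inr ⟨C, Finset.mem_univ C, le_rfl⟩)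
  have hμκ : ∀ E y, κ E y ≤ μ y := fun E y =>
    (Finset.fold_max_le _).2 ⟨(Finset.le_fold_max _).2 (Or.inl le_rfl), fun C _ => hμ y C⟩
  have hanti : ∀ E E' y, E' ≤ E → κ E y ≤ κ E' y := fun E E' y h =>
    (Finset.fold_max_le _).2 ⟨hκ0 E' y, fun C hC => (Finset.le_fold_max _).2
      (Or.inr ⟨C, by simpa using fun hC' => (by simpa using hC : ¬ C ≤ E) (hC'.trans h), le_rfl⟩)⟩
  have hbdd : ∀ (y : Y) (s : Finset P), (∀ C ∈ s, 0 < y.1 C) → BddAbove (s : Set P) := by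
    intro y s hs
    obtain ⟨-, b, hb⟩ := y.support_mem
    exact ⟨b, fun C hC => hb C ((y.mem_support_iff C).2 (hs C hC))⟩
  -- Positive exactly when `κ E y` lies below the largest coordinate and below `κ E' y` for every
  -- `E' < E`, which makes `E` the supremum of the superlevel set at height `κ E y`.
  let ω : P → Y → ℝ := fun E y =>
    (μ y - κ E y) * ∏ E' ∈ ({E' | E' < E} : Finset P), (κ E' y - κ E y)
  have hω0 : ∀ E y, 0 ≤ ω E y := fun E y => mul_nonneg (sub_nonneg.2 (hμκ E y))
    (Finset.prod_nonneg fun E' hE' => sub_nonneg.2 (hanti E E' y (by simpa using hE' : E' < E).le))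
  have hω : ∀ E y, 0 < ω E y ↔ κ E y < μ y ∧ ∀ E' < E, κ E y < κ E' y := by
    intro E y
    constructor
    · intro h
      refine ⟨lt_of_le_of_ne (hμκ E y) fun e => h.ne' ?_, fun E' hE' =>
        lt_of_le_of_ne (hanti _ _ _ hE'.le) fun e => h.ne' ?_⟩
      · simp [ω, e]
      · exact mul_eq_zero_of_right _ (Finset.prod_eq_zero (i := E') (by simpa using hE')
          (sub_eq_zero.2 e.symm))
    · rintro ⟨h1, h2⟩
      exact mul_pos (sub_pos.2 h1) (Finset.prod_pos fun E' hE' =>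
        sub_pos.2 (h2 E' (by simpa using hE')))
  have hlub : ∀ E y, 0 < ω E y → IsLUB {C | κ E y < y.1 C} E ∧ ∃ C, κ E y < y.1 C := by
    intro E y h
    obtain ⟨h1, h2⟩ := (hω E y).1 h
    have hex : ∃ C, κ E y < y.1 C := by
      by_contra! hcon
      exact h1.not_ge ((Finset.fold_max_le _).2 ⟨hκ0 E y, fun C _ => hcon C⟩)
    refine ⟨?_, hex⟩
    obtain ⟨C, hC⟩ := hex
    have hcoe : (({C | κ E y < y.1 C} : Finset P) : Set P) = {C | κ E y < y.1 C} := by simp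
    obtain ⟨E₀, hE₀⟩ := hP ({C | κ E y < y.1 C} : Finset P) ⟨C, by simpa using hC⟩
      (hbdd y _ fun C hC => (hκ0 E y).trans_lt (by simpa using hC))
    rw [hcoe] at hE₀
    -- If the supremum `E₀` were smaller than `E`, then `κ E y < κ E₀ y` would give an element of
    -- the superlevel set not below `E₀`.
    rcases (hE₀.2 fun C hC => hle E y C hC).eq_or_lt with rfl | hlt
    · exact hE₀
    · obtain hneg | ⟨C, hC, hlt'⟩ := (Finset.lt_fold_max _).1 (h2 E₀ hlt)
      · exact (hneg.not_ge (hκ0 E y)).elim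
      · exact ((by simpa using hC : ¬ C ≤ E₀) (hE₀.1 hlt')).elim
  -- Lowering the threshold enlarges the superlevel set and hence its supremum.
  have hchain : ∀ y E E', 0 < ω E y → 0 < ω E' y → κ E y ≤ κ E' y → E' ≤ E := by
    intro y E E' h h' hle'
    exact (hlub E' y h').1.2 fun C hC => (hlub E y h).1.1 (hle'.trans_lt hC)
  have hpos : ∀ y, ∃ E, 0 < ω E y := by
    intro y
    have hμ0 : 0 < μ y := by
      obtain ⟨C, hC⟩ := y.exists_pos
      exact hC.trans_le (hμ y C)
    obtain ⟨C₀, hC₀⟩ : ∃ C, μ y ≤ y.1 C := by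
      obtain h | ⟨C, -, hC⟩ := (Finset.le_fold_max _).1 (le_refl (μ y))
      · exact (h.not_gt hμ0).elim
      · exact ⟨C, hC⟩
    -- The supremum of the vertices with the largest coordinate has positive weight: no `E' < E`
    -- bounds them all, so `κ E' y` is at least that coordinate.
    obtain ⟨E, hE⟩ := hP ({C | μ y ≤ y.1 C} : Finset P) ⟨C₀, by simpa using hC₀⟩
      (hbdd y _ fun C hC => hμ0.trans_le (by simpa using hC))
    have hEle : ∀ C, μ y ≤ y.1 C → C ≤ E := fun C hC => hE.1 (by simpa using hC)
    have h1 : κ E y < μ y := by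
      refine (Finset.fold_max_lt _).2 ⟨hμ0, fun C hC => lt_of_not_ge fun hC' => ?_⟩
      exact (by simpa using hC : ¬ C ≤ E) (hEle C hC')
    refine ⟨E, (hω E y).2 ⟨h1, fun E' hE' => ?_⟩⟩
    refine h1.trans_le (le_of_not_gt fun hlt => hE'.not_ge (hE.2 fun C hC => hle E' y C ?_))
    exact hlt.trans_le (by simpa using hC)
  obtain ⟨g, hg⟩ := Realization.exists_continuousMap_of_weights (K := mcCordComplex P)
    Finset.univ ω (fun E _ => ((hfold _).sub (hfold _)).mul
      (continuous_finsetProd _ fun E' _ => (hfold _).sub (hfold _))) (fun E _ => hω0 E)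
    (fun y => by
      obtain ⟨E, hE⟩ := hpos y
      exact ⟨E, Finset.mem_univ E, hE⟩)
    (fun y => by
      obtain ⟨E, hE⟩ := hpos y
      refine ⟨({E | 0 < ω E y} : Finset P), ⟨⟨E, by simpa using hE⟩, ?_⟩,
        fun E _ hE => by simpa using hE⟩
      intro E hE E' hE' _
      have h1 : 0 < ω E y := by simpa using hE
      have h2 : 0 < ω E' y := by simpa using hE'
      rcases le_total (κ E y) (κ E' y) with h | h
      · exact Or.inr (hchain y E E' h1 h2 h)
      · exact Or.inl (hchain y E' E h2 h1 h))
  refine ⟨g, fun y E hE => ?_⟩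
  have hE' := (Realization.pos_of_weights (fun E _ => hω0 E y) (hg y) hE).2
  obtain ⟨hl, C, hC⟩ := hlub E y hE'
  exact ⟨({C | κ E y < y.1 C} : Finset P), ⟨C, by simpa using hC⟩,
    fun C hC => (hκ0 E y).trans_lt (by simpa using hC), by simpa using hl⟩

/-- If the bounded subsets of a finite poset have suprema, the realizations of the complex of chains
and of the upper Dowker complex are homotopy equivalent. -/
theorem exists_iso_mcCord_upperDowker
    (hP : ∀ s : Finset P, s.Nonempty → BddAbove (s : Set P) → ∃ a, IsLUB (s : Set P) a) :
    ∃ e : HTop.of (Realization (mcCordComplex P)) ≅ HTop.of (Realization (upperDowkerComplex P)),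
      e.hom = HTop.ofMap (mcCordInclusion P).realization := by
  obtain ⟨g, hg⟩ := exists_map_upperDowker_mcCord hP
  have := Realization.compactSpace_of_finite (mcCordComplex P)
  have := Realization.compactSpace_of_finite (upperDowkerComplex P)
  refine ⟨HTop.isoOfHomotopic (mcCordInclusion P).realization g ?_ ?_, rfl⟩
  -- On a chain the supremum of a nonempty finite subset is its greatest element, so no new vertex
  -- appears.
  · refine Realization.homotopic_of_pos_imp _ _ fun y E hE => ?_
    obtain ⟨s, hs, hsy, hlub⟩ := hg _ E hE
    simp only [mcCordInclusion_apply] at hsy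
    have hmem : s ∈ (mcCordComplex P).faces := ((mcCordComplex P).isRelLowerSet_faces
      y.support_mem).2 (fun C hC => (y.mem_support_iff C).2 (hsy C hC)) hs
    obtain ⟨M, hM⟩ := Finset.exists_maximal hs
    have hle : ∀ C ∈ s, C ≤ M := fun C hC => by
      rcases hmem.2.total hC hM.1 with h | h
      · exact h
      · exact hM.2 hC h
    have hME : M = E := le_antisymm (hlub.1 hM.1) (hlub.2 hle)
    exact hME ▸ hsy M hM.1
  · refine Realization.homotopic_of_common_face _ _ fun y => ?_
    classical
    have : Fintype P := Fintype.ofFinite P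
    obtain ⟨-, b, hb⟩ := y.support_mem
    obtain ⟨C, hC⟩ := y.exists_pos
    have hbC : ∀ C, 0 < y.1 C → C ≤ b := fun C hC => hb C ((y.mem_support_iff C).2 hC)
    -- An upper bound `b` of the carrier also bounds the suprema, so everything lies in the simplex
    -- of all elements below `b`.
    refine ⟨({C | C ≤ b} : Finset P), ⟨⟨C, by simpa using hbC C hC⟩, b, by simp⟩, fun E =>
      ⟨fun hE => ?_, fun hE => by simpa using hbC E hE⟩⟩
    obtain ⟨s, hs, hsy, hlub⟩ := hg y E ((mcCordInclusion_apply (g y) E).symm ▸ hE)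
    simpa using hlub.2 fun C hC => hbC C (hsy C hC)

variable {P : ℕ → Type u} [∀ n, PartialOrder (P n)] [∀ n, Finite (P n)]

/-- The inclusions commute strictly with the bonding maps, both being given by `p n` on vertices. -/
theorem mcCord_upperDowker_iff {X : Type u} [TopologicalSpace X]
    (hP : ∀ n (s : Finset (P n)), s.Nonempty → BddAbove (s : Set (P n)) →
      ∃ a, IsLUB (s : Set (P n)) a) (p : ∀ n, P (n + 1) →o P n) :
    IsHPolExpansion.{w} X (polyhedralSequence.{w} (fun n => mcCordComplex (P n))
      fun n => mcCordMap (p n)) ↔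
    IsHPolExpansion.{w} X (polyhedralSequence.{w} (fun n => upperDowkerComplex (P n))
      fun n => upperDowkerMap (p n)) := by
  choose e he using fun n => exists_iso_mcCord_upperDowker (hP n)
  have hcomm : ∀ n, HTop.ofMap (mcCordMap (p n)).realization ≫ (e n).hom =
      (e (n + 1)).hom ≫ HTop.ofMap (upperDowkerMap (p n)).realization := fun n => by
    rw [he, he, ← HTop.ofMap_comp, ← HTop.ofMap_comp, ← SimplicialMap.realization_comp,
      ← SimplicialMap.realization_comp]
    rfl
  refine ⟨fun h => h.of_levelwise e hcomm,
    fun h => h.of_levelwise (fun n => (e n).symm) fun n => ?_⟩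
  rw [Iso.symm_hom, Iso.symm_hom, Iso.comp_inv_eq, Category.assoc, hcomm, Iso.inv_hom_id_assoc]

/-- Needed for the chains of a poset and of its dual, which are the same sets but not
definitionally. -/
theorem polyhedralSequence_congr {V : ℕ → Type u} {K K' : ∀ n, AbstractSimplicialComplex (V n)}
    {f : ∀ n, SimplicialMap (K (n + 1)) (K n)} {f' : ∀ n, SimplicialMap (K' (n + 1)) (K' n)}
    (hK : K = K') (hf : ∀ n, (f n).toFun = (f' n).toFun) :
    polyhedralSequence.{w} K f = polyhedralSequence.{w} K' f' := by
  subst hK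
  have : f = f' := by
    funext n
    have h := hf n
    cases h₁ : f n
    cases h₂ : f' n
    rw [h₁, h₂] at h
    subst h
    rfl
  rw [this]

/-- Order duality: the lower Dowker complex is by definition the upper Dowker complex of the dual
order, where infima become suprema. -/
theorem mcCord_lowerDowker_iff {X : Type u} [TopologicalSpace X]
    (hP : ∀ n (s : Finset (P n)), s.Nonempty → BddBelow (s : Set (P n)) →
      ∃ a, IsGLB (s : Set (P n)) a) (p : ∀ n, P (n + 1) →o P n) :
    IsHPolExpansion.{w} X (polyhedralSequence.{w} (fun n => mcCordComplex (P n))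
      fun n => mcCordMap (p n)) ↔
    IsHPolExpansion.{w} X (polyhedralSequence.{w} (fun n => lowerDowkerComplex (P n))
      fun n => lowerDowkerMap (p n)) := by
  have h := mcCord_upperDowker_iff.{w} (X := X) (P := fun n => (P n)ᵒᵈ) hP fun n => (p n).dual
  have h₁ : polyhedralSequence.{w} (fun n => mcCordComplex (P n)ᵒᵈ)
      (fun n => mcCordMap (p n).dual) =
      polyhedralSequence.{w} (fun n => mcCordComplex (P n)) fun n => mcCordMap (p n) := by
    refine polyhedralSequence_congr (V := P) ?_ fun n => rfl
    funext n
    ext s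
    exact and_congr_right fun _ => ⟨fun h => h.symm, fun h => h.symm⟩
  rw [h₁] at h
  exact h

end Poset

/-! ### The six sequences of an adjusted approximative sequence -/

namespace AdjustedSequence

variable {X : Type u} [MetricSpace X] (D : AdjustedSequence X)

/-- Finiteness makes the diameter attained, so the strict inequality survives. -/
theorem diam_lt_of_dist_lt {s : Set X} (hs : s.Finite) (hne : s.Nonempty) {r : ℝ}
    (h : ∀ a ∈ s, ∀ b ∈ s, dist a b < r) : Metric.diam s < r := by
  obtain ⟨p, hp, hmax⟩ := (hs.prod hs).exists_maximalFor (fun p : X × X => dist p.1 p.2) _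
    (hne.prod hne)
  refine (Metric.diam_le_of_forall_dist_le dist_nonneg fun a ha b hb => ?_).trans_lt
    (h p.1 hp.1 p.2 hp.2)
  rcases le_total (dist a b) (dist p.1 p.2) with hle | hle
  · exact hle
  · exact hmax (j := (a, b)) ⟨ha, hb⟩ hle

theorem tendsto_two_mul : Filter.Tendsto (fun n => 2 * D.ε n) Filter.atTop (𝓝 0) := by
  simpa using D.tendsto_zero.const_mul 2

theorem lt_two_mul {n : ℕ} {t : ℝ} (h : t < D.ε n) : t < 2 * D.ε n := by
  linarith [D.pos n]

theorem diam_lt_of_dist_center_lt {n : ℕ} {x : X} {s : Set X} (hs : s.Finite) (hne : s.Nonempty)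
    (h : ∀ a ∈ s, dist x a < D.ε n) : Metric.diam s < 2 * D.ε n :=
  diam_lt_of_dist_lt hs hne fun a ha b hb => by
    linarith [dist_triangle_left a b x, h a ha, h b hb]

instance (n : ℕ) : Finite (D.cover n) :=
  Set.Finite.to_subtype (((D.A n).finite_toSet.image fun a => Metric.ball a (D.ε n)).subset (by
    rintro _ ⟨a, ha, rfl⟩
    exact ⟨a, ha, rfl⟩))

instance (n : ℕ) : Finite (D.U n) :=
  Set.Finite.to_subtype ((D.A n).finite_toSet.finite_subsets.subset fun _ h => h.2.1)

/-- The union is the supremum; its diameter is small because it lies in an upper bound. -/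
theorem exists_isLUB {n : ℕ} (s : Finset (D.U n)) (hs : s.Nonempty)
    (h : BddAbove (s : Set (D.U n))) : ∃ a, IsLUB (s : Set (D.U n)) a := by
  obtain ⟨E, hE⟩ := h
  have hsub : (⋃ C ∈ s, C.1) ⊆ E.1 := Set.iUnion₂_subset fun C hC => hE hC
  obtain ⟨C, hC⟩ := hs
  obtain ⟨a, ha⟩ := C.2.1
  refine ⟨⟨⋃ C ∈ s, C.1, ⟨a, Set.mem_biUnion hC ha⟩, hsub.trans E.2.2.1,
    (Metric.diam_mono hsub ((D.A n).finite_toSet.subset E.2.2.1).isBounded).trans_lt E.2.2.2⟩,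
    fun C hC => Set.subset_biUnion_of_mem (u := fun C : D.U n => C.1) hC,
    fun F hF => Set.iUnion₂_subset fun C hC => hF hC⟩

/-- The intersection is the infimum; it is nonempty because it contains a lower bound. -/
theorem exists_isGLB {n : ℕ} (s : Finset (D.U n)) (hs : s.Nonempty)
    (h : BddBelow (s : Set (D.U n))) : ∃ a, IsGLB (s : Set (D.U n)) a := by
  obtain ⟨E, hE⟩ := h
  obtain ⟨C, hC⟩ := hs
  have hEs : E.1 ⊆ ⋂ C ∈ s, C.1 := Set.subset_iInter₂ fun C hC => hE hC
  have hsub : ∀ C ∈ s, (⋂ C ∈ s, C.1) ⊆ C.1 := fun C hC => Set.iInter₂_subset C hC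
  let F : D.U n := ⟨⋂ C ∈ s, C.1, E.2.1.mono hEs, (hsub C hC).trans C.2.2.1,
    (Metric.diam_mono (hsub C hC)
      ((D.A n).finite_toSet.subset C.2.2.1).isBounded).trans_lt C.2.2.2⟩
  exact ⟨F, hsub, fun G hG => Set.subset_iInter₂ fun C hC => hG hC⟩

variable [CompactSpace X]

theorem dist_near_lt {n : ℕ} {x a b : X} (h : dist x a < D.ε (n + 1)) (hb : b ∈ D.near n a) :
    dist x b < D.ε n := by
  linarith [dist_triangle x a b, D.dist_le_of_mem_near hb, D.two_mul_add_lt n, D.pos (n + 1)]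

/-- The point where the adjustment `2ε_{n+1} + γ_n < ε_n` is used in full: a Vietoris–Rips bound at
one level becomes a Čech bound at the previous one. -/
theorem dist_near_lt_of_two_mul {n : ℕ} {x a b : X} (h : dist x a < 2 * D.ε (n + 1))
    (hb : b ∈ D.near n a) : dist x b < D.ε n := by
  linarith [dist_triangle x a b, D.dist_le_of_mem_near hb, D.two_mul_add_lt n]

/-- Complexes with vertices `A n` between the Čech complex and the Vietoris–Rips complex
approximate `X`. -/
def approximation {r : ∀ n, D.A (n + 1) → D.A n} (hr : D.IsNearestChoice r)
    (K : ∀ n, AbstractSimplicialComplex (D.A n)) (f : ∀ n, SimplicialMap (K (n + 1)) (K n))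
    (hf : ∀ n, (f n).toFun = r n)
    (hcech : ∀ n x (s : Finset (D.A n)), s.Nonempty → (∀ a ∈ s, dist x (a : X) < D.ε n) →
      s ∈ (K n).faces)
    (hrips : ∀ n, ∀ s ∈ (K n).faces, ∀ a ∈ s, ∀ b ∈ s, dist (a : X) b < 2 * D.ε n) :
    Approximation X K f where
  ρ _ a := a
  near n x a := dist x (a : X) < D.ε n
  mesh n := 2 * D.ε n
  tendsto_mesh := D.tendsto_two_mul
  isOpen_near n a := Metric.isOpen_ball
  exists_near n x := by
    obtain ⟨a, ha, hx⟩ := D.approx n x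
    exact ⟨⟨a, ha⟩, hx⟩
  mem_faces := hcech
  near_map n x a h := by
    rw [hf]
    exact D.dist_near_lt h (hr n a)
  exists_center n s hs := by
    -- Any vertex of the simplex serves as its centre.
    obtain ⟨a₀, ha₀⟩ := ((K (n + 1)).isRelLowerSet_faces hs).1
    refine ⟨a₀, fun a ha => ?_⟩
    have h := hrips _ s hs a₀ ha₀ a ha
    rw [hf]
    exact ⟨D.dist_near_lt_of_two_mul h (hr n a), h⟩
  dist_lt n x a h := D.lt_two_mul h

/-- The Vietoris–Rips complexes approximate `X`. -/
def ripsApproximation {r : ∀ n, D.A (n + 1) → D.A n} (hr : D.IsNearestChoice r) :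
    Approximation X D.rips (D.ripsMap hr) :=
  D.approximation hr _ _ (fun _ => rfl)
    (fun n x s hs h => ⟨hs, by
      rw [← isometry_subtype_coe.diam_image]
      refine D.diam_lt_of_dist_center_lt (x := x) (s.finite_toSet.image _)
        (hs.to_set.image _) ?_
      rintro _ ⟨a, ha, rfl⟩
      exact h a ha⟩)
    (fun n s hs a ha b hb =>
      (Metric.dist_le_diam_of_mem s.finite_toSet.isBounded ha hb).trans_lt hs.2)

/-- The witness complexes approximate `X`. -/
def witnessApproximation {r : ∀ n, D.A (n + 1) → D.A n} (hr : D.IsNearestChoice r) :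
    Approximation X D.witness (D.witnessMap hr) :=
  D.approximation hr _ _ (fun _ => rfl)
    (fun n x s hs h => ⟨hs, fun t ht hne => ⟨x, by
      exact (Finset.sum_lt_sum_of_nonempty hne fun a ha => h a (ht ha)).trans_eq (by simp)⟩⟩)
    (fun n s hs a ha b hb => by
      classical
      rcases eq_or_ne a b with rfl | hab
      · simpa using D.pos n
      -- A witness of an edge satisfies `d(x,a) + d(x,b) < 2ε_n`, which bounds `d(a,b)`.
      · obtain ⟨x, hx⟩ := hs.2 {a, b} (by simp [Finset.insert_subset_iff, ha, hb]) (by simp)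
        rw [Finset.sum_pair hab, Finset.card_pair hab] at hx
        push_cast at hx
        linarith [dist_triangle_left (a : X) b x])

/-- The nerves of the coverings by balls approximate `X`. -/
def cechApproximation {r : ∀ n, D.cover (n + 1) → D.cover n} (hr : D.IsNearestBallChoice r) :
    Approximation X D.cechNerve (D.cechMap hr) where
  -- A ball may have several centres in `A n`; any of them will do, even one other than the centre
  -- used by `r`.
  ρ n B := B.2.choose
  near n x B := x ∈ (B : Set X)
  mesh n := 2 * D.ε n
  tendsto_mesh := D.tendsto_two_mul
  isOpen_near n B := by
    obtain ⟨_, a, -, rfl⟩ := B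
    exact Metric.isOpen_ball
  exists_near n x := by
    obtain ⟨a, ha, hx⟩ := D.approx n x
    exact ⟨⟨_, a, ha, rfl⟩, hx⟩
  mem_faces n x s hs h := ⟨hs, x, h⟩
  near_map n x B h := by
    obtain ⟨a, -, hB, b, hb, hrB⟩ := hr n B
    change x ∈ (r n B : Set X)
    rw [hB, Metric.mem_ball] at h
    rw [hrB, Metric.mem_ball]
    exact D.dist_near_lt h hb
  exists_center n s hs := by
    obtain ⟨-, x, hx⟩ := hs
    refine ⟨x, fun B hB => ⟨?_, ?_⟩⟩
    · obtain ⟨a, -, hBa, b, hb, hrB⟩ := hr n B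
      have h := hx B hB
      change x ∈ (r n B : Set X)
      rw [hBa, Metric.mem_ball] at h
      rw [hrB, Metric.mem_ball]
      exact D.dist_near_lt h hb
    · have h := hx B hB
      rw [B.2.choose_spec.2, Metric.mem_ball] at h
      exact D.lt_two_mul h
  dist_lt n x B h := by
    rw [B.2.choose_spec.2, Metric.mem_ball] at h
    exact D.lt_two_mul h

/-- The upper Dowker complexes approximate `X`. -/
def upperDowkerApproximation :
    Approximation X (fun n => upperDowkerComplex (D.U n)) fun n => upperDowkerMap (D.p n) where
  ρ n C := C.2.1.choose
  near n x C := ∀ a ∈ C.1, dist x a < D.ε n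
  mesh n := 2 * D.ε n
  tendsto_mesh := D.tendsto_two_mul
  isOpen_near n C := by
    have h : {x | ∀ a ∈ C.1, dist x a < D.ε n} = ⋂ a ∈ C.1, Metric.ball a (D.ε n) := by
      ext x
      simp
    rw [h]
    exact ((D.A n).finite_toSet.subset C.2.2.1).isOpen_biInter fun _ _ => Metric.isOpen_ball
  exists_near n x := by
    obtain ⟨a, ha, hx⟩ := D.approx n x
    exact ⟨⟨{a}, Set.singleton_nonempty a, by simpa using ha, by simpa using D.pos n⟩,
      by simpa using hx⟩
  mem_faces n x s hs h := by
    have hne : (⋃ C ∈ s, C.1).Nonempty := by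
      obtain ⟨C, hC⟩ := hs
      obtain ⟨a, ha⟩ := C.2.1
      exact ⟨a, Set.mem_biUnion hC ha⟩
    have hsub : (⋃ C ∈ s, C.1) ⊆ (D.A n : Set X) := Set.iUnion₂_subset fun C _ => C.2.2.1
    refine ⟨hs, ⟨⋃ C ∈ s, C.1, hne, hsub, D.diam_lt_of_dist_center_lt (x := x)
      ((D.A n).finite_toSet.subset hsub) hne fun a ha => ?_⟩,
      fun C hC => Set.subset_biUnion_of_mem (u := fun C : D.U n => C.1) hC⟩
    obtain ⟨C, hC, haC⟩ := Set.mem_iUnion₂.1 ha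
    exact h C hC a haC
  near_map n x C h b hb := by
    obtain ⟨a, ha, hab⟩ := Set.mem_iUnion₂.1 hb
    exact D.dist_near_lt (h a ha) hab
  exists_center n s hs := by
    obtain ⟨-, E, hE⟩ := hs
    -- A point of an upper bound `E` is the centre: every member of the simplex lies in `E`, of
    -- diameter below `2ε_{n+1}`.
    obtain ⟨x, hx⟩ := E.2.1
    have h : ∀ C ∈ s, ∀ a ∈ C.1, dist x a < 2 * D.ε (n + 1) := fun C hC a ha =>
      (Metric.dist_le_diam_of_mem ((D.A (n + 1)).finite_toSet.subset E.2.2.1).isBounded hx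
        (hE C hC ha)).trans_lt E.2.2.2
    refine ⟨x, fun C hC => ⟨fun b hb => ?_, h C hC _ C.2.1.choose_spec⟩⟩
    obtain ⟨a, ha, hab⟩ := Set.mem_iUnion₂.1 hb
    exact D.dist_near_lt_of_two_mul (h C hC a ha) hab
  dist_lt n x C h := D.lt_two_mul (h _ C.2.1.choose_spec)

theorem isHPolExpansion_upperDowker : IsHPolExpansion.{w} X D.upperDowker := by
  rw [upperDowker]
  exact D.upperDowkerApproximation.isHPolExpansion

theorem isHPolExpansion_alexandroffMcCord : IsHPolExpansion.{w} X D.alexandroffMcCord := by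
  rw [alexandroffMcCord]
  exact (mcCord_upperDowker_iff.{w} (P := D.U) (fun _ => D.exists_isLUB) fun n => D.p n).2
    D.isHPolExpansion_upperDowker

theorem isHPolExpansion_lowerDowker : IsHPolExpansion.{w} X D.lowerDowker := by
  rw [lowerDowker]
  exact (mcCord_lowerDowker_iff.{w} (P := D.U) (fun _ => D.exists_isGLB) fun n => D.p n).1
    D.isHPolExpansion_alexandroffMcCord

end AdjustedSequence

end PolyhedralShape

end

open PolyhedralShape in
theorem mainTheorem1 {X : Type u} [MetricSpace X] [CompactSpace X] (D : AdjustedSequence X) :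
    IsHPolExpansion.{w} X D.alexandroffMcCord ∧
    (∀ (r : ∀ n, D.cover (n + 1) → D.cover n) (hr : D.IsNearestBallChoice r),
      IsHPolExpansion.{w} X (D.cechSequence hr)) ∧
    (∀ (r : ∀ n, D.A (n + 1) → D.A n) (hr : D.IsNearestChoice r),
      IsHPolExpansion.{w} X (D.witnessSequence hr)) ∧
    (∀ (r : ∀ n, D.A (n + 1) → D.A n) (hr : D.IsNearestChoice r),
      IsHPolExpansion.{w} X (D.ripsSequence hr)) ∧
    IsHPolExpansion.{w} X D.upperDowker ∧
    IsHPolExpansion.{w} X D.lowerDowker := by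
  exact ⟨D.isHPolExpansion_alexandroffMcCord,
    fun _ hr => (D.cechApproximation hr).isHPolExpansion,
    fun _ hr => (D.witnessApproximation hr).isHPolExpansion,
    fun _ hr => (D.ripsApproximation hr).isHPolExpansion,
    D.isHPolExpansion_upperDowker, D.isHPolExpansion_lowerDowker⟩
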